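/- Let $n\ge 1$, $c>0$, $\theta\in(0,\pi)$. Let $\mathbb H^{n+1}=\{x\in\mathbb R^{n+1}:x_{n+1}>0\}$ carry the hyperbolic metric $\langle\cdot,\cdot\rangle=x_{n+1}^{-2}\langle\cdot,\cdot\rangle_\delta$, where $\delta$ is the Euclidean metric, let $E_1,\dots,E_{n+1}$ be the coordinate vectors, $P=\{x\in\mathbb H^{n+1}:x_1=0\}$, $P_+=\{x\in\mathbb H^{n+1}:x_1>0\}$, and let $\bar N=-x_{n+1}E_1$ be the unit normal of $P$ pointing out of $P_+$. For $R>0$ let $$\mathcal C_{c,R,\theta}=\{x\in\mathbb H^{n+1}: |x+R\cos\theta\,E_1-cE_{n+1}|_\delta\le R,\ x_1\ge 0\}.$$ A $\theta$-capillary hypersurface is an embedding $x:M\to\mathbb H^{n+1}$ of a compact connected $n$-manifold $M$ with boundary such that $x(\operatorname{int}M)\subset P_+$, $x(\partial M)\subset P$ and $\langle\nu,\bar N\rangle=-\cos\theta$ on $\partial M$, where $\nu$ is the unit normal pointing out of the domain enclosed by $x(M)$ and $P$. It is star-shaped with respect to $cE_{n+1}$ if $\langle x-cE_{n+1},\nu\rangle>0$.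 Let $x:M\times[0,T)\to\mathbb H^{n+1}$, $0<T\le\infty$, be a family of $\theta$-capillary hypersurfaces which is a classical solution of the flow $$(\partial_t x)^{\perp}=q_c\,\nu,\qquad q_c=\frac{nc}{x_{n+1}}-nc\cos\theta\,\langle E_1,\nu\rangle-H\langle x-cE_{n+1},\nu\rangle ,$$ where $H$ is the mean curvature (the sum of the principal curvatures). (1) If $x(M,0)$ is star-shaped with respect to $cE_{n+1}$ and $x(M,0)\subset\mathcal C_{c,R_1,\theta}\setminus\mathcal C_{c,R_2,\theta}$ for some $R_1>R_2>0$, then $x(M,t)\subset\mathcal C_{c,R_1,\theta}\setminus\mathcal C_{c,R_2,\theta}$ for all $t\in[0,T)$. (2) On the closed hemisphere $\bar{\mathbb S}^n_+=\{|z|=1,\ z_1\ge0\}$ consider the scalar form of the flow, for radial graphs $x=cE_{n+1}+\rho z$ in $\mathbb H^{n+1}$, $\rho=e^{u(z,t)}$: $$u_t=\frac{v\,x_{n+1}}{\rho}\,q_c\ \text{ on }\ \bar{\mathbb S}^n_+\times[0,T),\qquad -\langle E_1,\nabla u\rangle_\delta=v\cos\theta\ \text{ on }\ \partial\mathbb S^n_+\times[0,T),\qquad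 u(\cdot,0)=u_0,$$ where $\nabla u$ is the gradient on the sphere, $v=\sqrt{1+|\nabla u|^2}$, and $q_c$ is the velocity above for the graph with unit normal $\nu=x_{n+1}(z-\nabla u)/v$. For every $K$ there is a constant $C$, depending only on $n,c,\theta,K$ (and not on $T\in(0,\infty]$), such that every classical solution $u$ on $[0,T)$ with $\sup|u_0|\le K$ satisfies $|u|\le C$ on $\bar{\mathbb S}^n_+\times[0,T)$. -/

import Mathlib

open scoped Manifold ContDiff Topology

noncomputable section

namespace HypCapillary

/-! ### The half-space model of hyperbolic space

`ℝ^{n+1}` has coordinates indexed by `Fin (n + 1)`: the coordinate written `x₁` in the usual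
notation has index `0`, and the height `x_{n+1}` has index `Fin.last n`. -/

/-- The ambient Euclidean space `ℝ^{n+1}`. -/
abbrev Amb (n : ℕ) : Type := EuclideanSpace ℝ (Fin (n + 1))

/-- The height coordinate `x_{n+1}`. -/
def height {n : ℕ} (x : Amb n) : ℝ := x (Fin.last n)

/-- The coordinate vector `E₁`. -/
def E₁ (n : ℕ) : Amb n := EuclideanSpace.single 0 1

/-- The coordinate vector `E_{n+1}`. -/
def Eₗ (n : ℕ) : Amb n := EuclideanSpace.single (Fin.last n) 1

/-- Hyperbolic space `ℍ^{n+1}`, as the upper half-space. -/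
def Hyp (n : ℕ) : Set (Amb n) := {x | 0 < height x}

/-- The open half `P₊` of hyperbolic space on the side `x₁ > 0` of the totally geodesic
hyperplane `P = {x₁ = 0}`. -/
def PPlus (n : ℕ) : Set (Amb n) := {x | x ∈ Hyp n ∧ 0 < x 0}

/-- The hyperplane `P`. -/
def PPlane (n : ℕ) : Set (Amb n) := {x | x ∈ Hyp n ∧ x 0 = 0}

/-- The hyperbolic metric `x_{n+1}⁻² ⟨·,·⟩` at the point `x`. -/
def hypInner {n : ℕ} (x v w : Amb n) : ℝ := inner ℝ v w / height x ^ 2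

/-- The Christoffel tensor of the hyperbolic metric: the Levi-Civita connection is
`∇_X Y = D_X Y + Γ(X, Y)`, with `D` the Euclidean derivative. (For a conformal metric `e^{2w} δ`
one has `Γ(X, Y) = dw(X) Y + dw(Y) X - ⟨X, Y⟩ grad w`; here `w = - log x_{n+1}`.) -/
def hypChristoffel {n : ℕ} (x X Y : Amb n) : Amb n :=
  -((height x)⁻¹ • (height X • Y + height Y • X - (inner ℝ X Y : ℝ) • Eₗ n))

/-- The outer unit normal `N` of `P`, pointing away from `P₊`. -/
def planeNormal {n : ℕ} (x : Amb n) : Amb n := -(height x • E₁ n)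

/-- The (solid) `θ`-umbilical cap `C_{c,R,θ}(a)`, for `a` perpendicular to `E₁` and `E_{n+1}`. -/
def cap {n : ℕ} (c R θ : ℝ) (a : Amb n) : Set (Amb n) :=
  {x | x ∈ Hyp n ∧ ‖x + (R * Real.cos θ) • E₁ n - a - c • Eₗ n‖ ≤ R ∧ 0 ≤ x 0}

/-- The time interval `[0, T)`, where `T = ⊤` is allowed. -/
def timeInterval (T : EReal) : Set ℝ := {t | 0 ≤ t ∧ (t : EReal) < T}

/-! ### Hypersurfaces and the flow -/

section Hypersurface

variable {n : ℕ} [NeZero n] {M : Type*} [TopologicalSpace M]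
  [ChartedSpace (EuclideanHalfSpace n) M]

/-- The differential of a map `f : M → ℝ^{n+1}` at `p`. -/
def diff (f : M → Amb n) (p : M) : TangentSpace (𝓡∂ n) p →L[ℝ] Amb n :=
  mfderiv (𝓡∂ n) 𝓘(ℝ, Amb n) f p

/-- The `i`-th coordinate vector of the preferred chart at `p`. -/
def coordVec (p : M) (i : Fin n) : TangentSpace (𝓡∂ n) p :=
  (EuclideanSpace.single i (1 : ℝ) : EuclideanSpace ℝ (Fin n))

/-- The hyperbolic covariant derivative `∇_v ν` of a vector field `ν` along `x`. -/
def covDeriv (x ν : M → Amb n) (p : M) (v : TangentSpace (𝓡∂ n) p) : Amb n :=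
  diff ν p v + hypChristoffel (x p) (diff x p v) (ν p)

/-- The first fundamental form `g_{ij}` induced by the hyperbolic metric. -/
def firstForm (x : M → Amb n) (p : M) : Matrix (Fin n) (Fin n) ℝ :=
  Matrix.of fun i j => hypInner (x p) (diff x p (coordVec p i)) (diff x p (coordVec p j))

/-- The second fundamental form `h_{ij} = ⟨∇_{∂_i} ν, ∂_j⟩`. -/
def secondForm (x ν : M → Amb n) (p : M) : Matrix (Fin n) (Fin n) ℝ :=
  Matrix.of fun i j => hypInner (x p) (covDeriv x ν p (coordVec p i)) (diff x p (coordVec p j))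

/-- The mean curvature `H = g^{ij} h_{ij}` (the sum of the principal curvatures). -/
def meanCurvature (x ν : M → Amb n) (p : M) : ℝ :=
  ((firstForm x p)⁻¹ * secondForm x ν p).trace

/-- The normal velocity
`q_c = n c / x_{n+1} - n c cos θ ⟨E₁, ν⟩ - H ⟨x - c E_{n+1}, ν⟩`. -/
def normalSpeed (c θ : ℝ) (x ν : M → Amb n) (p : M) : ℝ :=
  n * c / height (x p) - n * c * Real.cos θ * hypInner (x p) (E₁ n) (ν p)
    - meanCurvature x ν p * hypInner (x p) (x p - c • Eₗ n) (ν p)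

/-- `Ω` is the domain enclosed by the hypersurface `x(M)` and the hyperplane `P`. -/
structure IsEnclosedDomain (x : M → Amb n) (Ω : Set (Amb n)) : Prop where
  isOpen : IsOpen Ω
  isConnected : IsConnected Ω
  subset : Ω ⊆ PPlus n
  /-- `Ω` is bounded in hyperbolic space. -/
  bounded : ∃ K, IsCompact K ∧ K ⊆ Hyp n ∧ Ω ⊆ K
  frontier_eq : frontier Ω ∩ PPlus n = Set.range x ∩ PPlus n

/-- `ν` points out of `Ω` along `x(M)`: a short segment that leaves `x p` into `P₊` lies inside
`Ω` if it starts to the side of `-ν`, and outside `Ω` if it starts to the side of `ν`. -/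
def PointsOutOf (x ν : M → Amb n) (Ω : Set (Amb n)) : Prop :=
  ∀ (p : M) (w : Amb n), (∀ᶠ s : ℝ in 𝓝[>] 0, x p + s • w ∈ PPlus n) →
    (hypInner (x p) w (ν p) < 0 → ∀ᶠ s : ℝ in 𝓝[>] 0, x p + s • w ∈ Ω) ∧
    (0 < hypInner (x p) w (ν p) → ∀ᶠ s : ℝ in 𝓝[>] 0, x p + s • w ∉ Ω)

/-- `ν` is the outer unit normal field of the hypersurface `x : M → ℍ^{n+1}` supported on `P`. -/
structure IsOuterUnitNormal (x ν : M → Amb n) : Prop where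
  regular : ContMDiff (𝓡∂ n) 𝓘(ℝ, Amb n) 1 ν
  unit : ∀ p, hypInner (x p) (ν p) (ν p) = 1
  orthogonal : ∀ p v, hypInner (x p) (diff x p v) (ν p) = 0
  outer : ∃ Ω, IsEnclosedDomain x Ω ∧ PointsOutOf x ν Ω

/-- `x : M → ℍ^{n+1}` is an embedded `θ`-capillary hypersurface supported on `P`, with outer unit
normal `ν`; the contact angle is expressed by `⟨ν, N⟩ = - cos θ` on the boundary. -/
structure IsCapillary (θ : ℝ) (x ν : M → Amb n) : Prop where
  regular : ContMDiff (𝓡∂ n) 𝓘(ℝ, Amb n) 2 x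
  immersion : ∀ p, Function.Injective (diff x p)
  embedding : Topology.IsEmbedding x
  interior_subset : ∀ p ∈ (𝓡∂ n).interior M, x p ∈ PPlus n
  boundary_subset : ∀ p ∈ (𝓡∂ n).boundary M, x p ∈ PPlane n
  normal : IsOuterUnitNormal x ν
  angle : ∀ p ∈ (𝓡∂ n).boundary M, hypInner (x p) (ν p) (planeNormal (x p)) = -Real.cos θ

/-- Star-shapedness with respect to `c E_{n+1}`. -/
def IsStarShaped (c : ℝ) (x ν : M → Amb n) : Prop :=
  ∀ p, 0 < hypInner (x p) (x p - c • Eₗ n) (ν p)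

/-- The component `V^⊥` of a vector `V` at `x` along the hyperbolic unit normal `ν`. -/
def normalPart (x ν V : Amb n) : Amb n := hypInner x V ν • ν

/-- The family `x t : M → ℍ^{n+1}`, `t ∈ [0, T)`, of embedded `θ`-capillary hypersurfaces with
outer unit normals `ν t` is a (classical) solution of the flow `(∂_t x)^⊥ = q_c ν`. -/
structure IsFlow (c θ : ℝ) (T : EReal) (x ν : ℝ → M → Amb n) : Prop where
  regular : ContMDiffOn (𝓘(ℝ, ℝ).prod (𝓡∂ n)) 𝓘(ℝ, Amb n) 1 (Function.uncurry x)
    (timeInterval T ×ˢ Set.univ)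
  normal_continuous : ContinuousOn (Function.uncurry ν) (timeInterval T ×ˢ Set.univ)
  capillary : ∀ t ∈ timeInterval T, IsCapillary θ (x t) (ν t)
  evolution : ∀ t ∈ timeInterval T, ∀ p,
    normalPart (x t p) (ν t p) (derivWithin (fun s => x s p) (timeInterval T) t)
      = normalSpeed c θ (x t) (ν t) p • ν t p

end Hypersurface

/-! ### The scalar equation on the hemisphere

A function `f` on the closed hemisphere is differentiated through its extension to the cone over
the hemisphere that is constant along rays. At a point `z` of the unit sphere the Euclidean
gradient of this extension is the gradient of `f` on the sphere; its Euclidean Hessian agrees on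
tangent vectors with the Hessian of `f` on the sphere and vanishes on `(z, z)`, so that its
Euclidean Laplacian is the Laplacian of `f` on the sphere. -/

section Scalar

variable {n : ℕ}

/-- The closed hemisphere `{|z| = 1, z₁ ≥ 0}`. -/
def hemisphere (n : ℕ) : Set (Amb n) := {z | ‖z‖ = 1 ∧ 0 ≤ z 0}

/-- The cone over the closed hemisphere, without its apex. -/
def hemiCone (n : ℕ) : Set (Amb n) := {y | y ≠ 0 ∧ 0 ≤ y 0}

/-- The extension of a function on the sphere that is constant along rays. -/
def radialExt (f : Amb n → ℝ) (y : Amb n) : ℝ := f (‖y‖⁻¹ • y)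

/-- The gradient of `f` on the hemisphere at `z`. -/
def sphGrad (f : Amb n → ℝ) (z : Amb n) : Amb n :=
  gradientWithin (radialExt f) (hemiCone n) z

/-- The Hessian of `f` on the hemisphere at `z` (to be evaluated on tangent vectors). -/
def sphHess (f : Amb n → ℝ) (z X Y : Amb n) : ℝ :=
  fderivWithin ℝ (fderivWithin ℝ (radialExt f) (hemiCone n)) (hemiCone n) z X Y

/-- The Laplacian of `f` on the hemisphere at `z`. -/
def sphLap (f : Amb n → ℝ) (z : Amb n) : ℝ :=
  ∑ i, sphHess f z (EuclideanSpace.single i 1) (EuclideanSpace.single i 1)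

/-- `v = √(1 + |∇u|²)`. -/
def slope (u : Amb n → ℝ) (z : Amb n) : ℝ := √(1 + ‖sphGrad u z‖ ^ 2)

/-- The point `c E_{n+1} + e^{u(z)} z` of the radial graph of `ρ = e^u`. -/
def graphPoint (c : ℝ) (u : Amb n → ℝ) (z : Amb n) : Amb n := c • Eₗ n + Real.exp (u z) • z

/-- The Euclidean outer unit normal `(z - ∇u) / v` of the radial graph. -/
def graphNormal (u : Amb n → ℝ) (z : Amb n) : Amb n := (slope u z)⁻¹ • (z - sphGrad u z)

/-- The contraction `(σ^{ij} - u^i u^j / v²) u_{ij}`. -/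
def graphContraction (u : Amb n → ℝ) (z : Amb n) : ℝ :=
  sphLap u z - sphHess u z (sphGrad u z) (sphGrad u z) / slope u z ^ 2

/-- The hyperbolic mean curvature of the radial graph,
`H = x_{n+1} (n / (ρ v) - (ρ v)⁻¹ (σ^{ij} - u^i u^j / v²) u_{ij}) - n ⟨E_{n+1}, (z - ∇u) / v⟩`. -/
def graphMeanCurvature (c : ℝ) (u : Amb n → ℝ) (z : Amb n) : ℝ :=
  height (graphPoint c u z) * (n - graphContraction u z) / (Real.exp (u z) * slope u z)
    - n * height (graphNormal u z)

/-- The normal velocity `q_c` of the radial graph; its hyperbolic unit normal is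
`ν = x_{n+1} (z - ∇u) / v`. -/
def graphSpeed (c θ : ℝ) (u : Amb n → ℝ) (z : Amb n) : ℝ :=
  let x := graphPoint c u z
  let ν := height x • graphNormal u z
  n * c / height x - n * c * Real.cos θ * hypInner x (E₁ n) ν
    - graphMeanCurvature c u z * hypInner x (x - c • Eₗ n) ν

/-- The right-hand side `Q_c = v x_{n+1} q_c / ρ` of the scalar equation `u_t = Q_c`. -/
def scalarRHS (c θ : ℝ) (u : Amb n → ℝ) (z : Amb n) : ℝ :=
  slope u z * height (graphPoint c u z) / Real.exp (u z) * graphSpeed c θ u z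

/-- `u` is a classical solution on `[0, T)` of the initial boundary value problem on the closed
hemisphere for the logarithmic radial function of the flow. In the boundary condition
`u_β = √(1 + |∇u|²) cos θ` the vector `∂_β = - E₁` is the outer conormal of the hemisphere. -/
structure IsScalarSolution (c θ : ℝ) (T : EReal) (u : ℝ → Amb n → ℝ) : Prop where
  continuous : ContinuousOn (Function.uncurry u) (timeInterval T ×ˢ hemisphere n)
  regular : ∀ t ∈ timeInterval T, ContDiffOn ℝ 2 (radialExt (u t)) (hemiCone n)
  /-- The radial graph lies in hyperbolic space. -/
  graph_mem : ∀ t ∈ timeInterval T, ∀ z ∈ hemisphere n, graphPoint c (u t) z ∈ Hyp n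
  evolution : ∀ t ∈ timeInterval T, ∀ z ∈ hemisphere n,
    HasDerivWithinAt (fun s => u s z) (scalarRHS c θ (u t) z) (timeInterval T) t
  boundary : ∀ t ∈ timeInterval T, ∀ z ∈ hemisphere n, z 0 = 0 →
    inner ℝ (sphGrad (u t) z) (-E₁ n) = slope (u t) z * Real.cos θ

end Scalar

end HypCapillary

end

open HypCapillary

namespace HypCapillary

open Set Filter

/-! ### One-variable calculus -/

/-! The spherical boundaries of the caps `cap c r θ 0`, `r > 0`, are stationary barriers. Such a
sphere is umbilical with all principal curvatures `c / r`, meets `P` at the prescribed angle, and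
satisfies `q_c = 0`. They foliate the quarter space around `c E_{n+1}`, so a point `x` is measured
by the radius of the sphere through it, `capRadius θ (x - c E_{n+1})`. Both claims say that the
spatial maximum of this function does not increase in time and its spatial minimum does not
decrease.

At a spatial extremum of value `m` the hypersurface touches the cap of radius `m` from one side. In
the interior the tangent planes agree. At a boundary point the extremum only controls directions
along the boundary, but the contact angle is that of the cap, and this forces the normals to agree
there as well, so no Hopf lemma is needed. The second order condition then holds in every tangent
direction, since it is even in the direction and one of `±v` points inwards. It compares the second
fundamental form with `(c / m) g`, hence `H` with `n c / m`, and this fixes the sign of `q_c`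
because `q_c = -(H - n c / m) m (x_{n+1} - cos θ ν₀) / x_{n+1}²` at the contact point
(`normalSpeed_at_extremum`; `scalarRHS_at_extremum` for graphs). The parabolic maximum principle
`le_of_forall_max_not_barrier` concludes.

For graphs, homogeneity of `capRadius` turns the quantity into `u + log (capRadius θ z)`, and `log
(capRadius θ ·)` is bounded on the hemisphere; this gives the bound on `u`, uniformly in `T`.

For the embedded flow the orientation of `ν` at the contact points has to be settled too. At the
outer cap, the enclosed domain lies in the same ball as the hypersurface
(`norm_sub_le_of_mem_enclosed`), so `ν` is the outer normal of the cap. At the inner cap there are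
two alternatives, according to whether the cap lies inside the domain. Star-shapedness selects one
at time `0`, and connectedness of the time interval preserves it (`IsFlow.normal_eq_of_min`);
star-shapedness at later times is not needed. That argument requires the hypersurface to stay away
from `c E_{n+1}`, which a first-time argument supplies (`IsFlow.lt_capRadius`). -/

theorem deriv_right_nonpos_of_le {k : ℝ → ℝ} {d : ℝ} (hk : HasDerivWithinAt k d (Ici 0) 0)
    (hle : ∀ᶠ s in 𝓝[>] (0 : ℝ), k s ≤ k 0) : d ≤ 0 := by
  have h1 : Tendsto (_root_.slope k 0) (𝓝[>] 0) (𝓝 d) := by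
    have := (hk.mono Ioi_subset_Ici_self)
    exact (hasDerivWithinAt_iff_tendsto_slope' (by simp)).1 this
  refine le_of_tendsto h1 ?_
  filter_upwards [hle, self_mem_nhdsWithin] with s hs hs0
  rw [slope_def_field, sub_zero]
  exact div_nonpos_of_nonpos_of_nonneg (by linarith) (le_of_lt hs0)

theorem le_deriv_left_of_barrier {k : ℝ → ℝ} {d ε t : ℝ} (hk : HasDerivWithinAt k d (Iic t) t)
    (hle : ∀ᶠ s in 𝓝[<] t, k s ≤ k t - ε * (t - s)) : ε ≤ d := by
  have h1 : Tendsto (_root_.slope k t) (𝓝[<] t) (𝓝 d) :=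
    (hasDerivWithinAt_iff_tendsto_slope' (by simp)).1 (hk.mono Iio_subset_Iic_self)
  refine ge_of_tendsto h1 ?_
  filter_upwards [hle, self_mem_nhdsWithin] with s hs hs0
  have hs0 : s < t := hs0
  rw [slope_def_field, ← neg_div_neg_eq, le_div_iff₀ (by linarith)]
  linarith

/-- Second derivative test at a one-sided maximum; `L` plays the role of `k''(0)`. -/
theorem nonpos_of_tendsto_deriv_div {k k' : ℝ → ℝ} {L ε : ℝ} (hε : 0 < ε)
    (hk : ∀ s ∈ Ico 0 ε, HasDerivWithinAt k (k' s) (Ico 0 ε) s)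
    (hmax : ∀ s ∈ Ico 0 ε, k s ≤ k 0)
    (hL : Tendsto (fun s => k' s / s) (𝓝[>] 0) (𝓝 L)) : L ≤ 0 := by
  -- If `L > 0`, then `k' > 0` just to the right of `0`, while the mean value theorem provides
  -- points there with `k' ≤ 0`.
  by_contra! hpos
  have h1 : ∀ᶠ s in 𝓝[>] (0 : ℝ), 0 < k' s / s := hL.eventually (lt_mem_nhds hpos)
  obtain ⟨δ, hδ, hδ'⟩ := mem_nhdsGT_iff_exists_Ioo_subset.1 h1
  have hδ : 0 < δ := hδ
  set r := min δ ε / 2 with hr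
  have hm : 0 < min δ ε := lt_min hδ hε
  have hr0 : 0 < r := by positivity
  have hrδ : r < δ := by have := min_le_left δ ε; linarith
  have hrε : r < ε := by have := min_le_right δ ε; linarith
  have hsub : ∀ s ∈ Icc 0 r, s ∈ Ico 0 ε := fun s hs => ⟨hs.1, hs.2.trans_lt hrε⟩
  obtain ⟨s, hs, hs'⟩ := exists_hasDerivAt_eq_slope k k' hr0
    (fun s hs => (hk s (hsub s hs)).continuousWithinAt.mono fun y hy => hsub y hy)
    (fun s hs => (hk s (hsub s ⟨hs.1.le, hs.2.le⟩)).hasDerivAt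
      (Ico_mem_nhds hs.1 (hs.2.trans hrε)))
  have h2 : 0 < k' s / s := hδ' ⟨hs.1, hs.2.trans hrδ⟩
  have h3 : k' s ≤ 0 := by
    rw [hs']
    exact div_nonpos_of_nonpos_of_nonneg (by linarith [hmax r (hsub r ⟨hr0.le, le_rfl⟩)])
      (by linarith)
  have := div_nonpos_of_nonpos_of_nonneg h3 hs.1.le
  linarith

/-- A parabolic maximum principle: a bound at time `0` persists if at no spatial maximum the
function has grown at a positive rate. -/
theorem le_of_forall_max_not_barrier {P : Type*} [TopologicalSpace P] {S : Set P}
    (hS : IsCompact S) {b m : ℝ} {φ : ℝ → P → ℝ}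
    (hφ : ContinuousOn (Function.uncurry φ) (Icc 0 b ×ˢ S))
    (h0 : ∀ p ∈ S, φ 0 p ≤ m)
    (hstep : ∀ ε > 0, ∀ t ∈ Ioc 0 b, ∀ p ∈ S, m < φ t p → (∀ q ∈ S, φ t q ≤ φ t p) →
      ¬ ∀ s ∈ Icc 0 t, φ s p ≤ φ t p - ε * (t - s)) :
    ∀ t ∈ Icc 0 b, ∀ p ∈ S, φ t p ≤ m := by
  intro t ht p hp
  by_contra! hlt
  obtain ⟨ε, hε, hεt⟩ : ∃ ε > 0, m < φ t p - ε * t := by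
    have ht0 : 0 ≤ t := ht.1
    refine ⟨(φ t p - m) / (t + 1), div_pos (by linarith) (by linarith), ?_⟩
    have : (φ t p - m) / (t + 1) * t < φ t p - m := by
      rw [div_mul_eq_mul_div, div_lt_iff₀ (by positivity)]
      nlinarith
    linarith
  -- Maximise `φ - ε t` over space-time. The choice of `ε` keeps the maximum above `m`, which
  -- excludes `τ = 0`; comparison with earlier times at `q` gives growth at rate at least `ε`.
  obtain ⟨⟨τ, q⟩, ⟨hτ, hq⟩, hmax⟩ := (isCompact_Icc.prod hS).exists_isMaxOn
    (f := fun y : ℝ × P => Function.uncurry φ y - ε * y.1) ⟨(t, p), ht, hp⟩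
    (hφ.sub (by fun_prop))
  have hmax' : ∀ s ∈ Icc 0 b, ∀ r ∈ S, φ s r - ε * s ≤ φ τ q - ε * τ :=
    fun s hs r hr => hmax (show (s, r) ∈ Icc 0 b ×ˢ S from ⟨hs, hr⟩)
  have hτ : τ ∈ Icc 0 b := hτ
  have hq : q ∈ S := hq
  have h1 := hmax' t ht p hp
  rcases hτ.1.eq_or_lt with h | h
  · have h2 := h0 q hq
    rw [← h] at h1
    linarith
  · have h2 : 0 < ε * τ := by positivity
    refine hstep ε hε τ ⟨h, hτ.2⟩ q hq (by linarith)
      (fun r hr => by linarith [hmax' τ hτ r hr]) fun s hs => ?_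
    linarith [hmax' s ⟨hs.1, hs.2.trans hτ.2⟩ q hq]

/-! ### A trace inequality -/

open scoped MatrixOrder in
-- Writing `F⁻¹ = Bᴴ B`, the trace becomes that of `B Q Bᴴ`, a sum of values of the quadratic form
-- of `Q` on the rows of `B`. Symmetry of `Q` plays no role, so that of the second fundamental form
-- need not be proved.
theorem trace_inv_mul_nonneg {n : ℕ} {F Q : Matrix (Fin n) (Fin n) ℝ} (hF : F.PosDef)
    (hQ : ∀ v : Fin n → ℝ, 0 ≤ v ⬝ᵥ Q.mulVec v) : 0 ≤ (F⁻¹ * Q).trace := by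
  obtain ⟨B, hB⟩ := CStarAlgebra.nonneg_iff_eq_star_mul_self.mp hF.inv.posSemidef.nonneg
  rw [Matrix.star_eq_conjTranspose] at hB
  rw [hB, Matrix.mul_assoc, Matrix.trace_mul_comm, Matrix.trace]
  refine Finset.sum_nonneg fun i _ => ?_
  have : (B * Q * B.conjTranspose).diag i = (B i) ⬝ᵥ Q.mulVec (B i) := by
    rw [Matrix.diag_apply, Matrix.mul_assoc, Matrix.mul_apply]
    simp [dotProduct, Matrix.mulVec, Matrix.mul_apply]
  rw [this]
  exact hQ _

/-- A connected set that misses the frontier of an open set lies inside it or outside it. -/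
theorem subset_or_disjoint_of_disjoint_frontier {X : Type*} [TopologicalSpace X] {S Ω : Set X}
    (hS : IsPreconnected S) (hΩ : IsOpen Ω) (h : Disjoint S (frontier Ω)) :
    S ⊆ Ω ∨ Disjoint S Ω := by
  have hcover : S ⊆ Ω ∪ (closure Ω)ᶜ := by
    intro x hx
    by_cases hxΩ : x ∈ Ω
    · exact Or.inl hxΩ
    · refine Or.inr fun hxc => h.le_bot ⟨hx, ?_⟩
      rw [hΩ.frontier_eq]
      exact ⟨hxc, hxΩ⟩
  rcases hS.subset_or_subset hΩ isClosed_closure.isOpen_compl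
    (disjoint_compl_right.mono_left subset_closure) hcover with h1 | h1
  · exact Or.inl h1
  · exact Or.inr ((disjoint_compl_left.mono_left h1).mono_right subset_closure)

/-! ### Coordinates -/

section Coordinates

variable {n : ℕ}

theorem inner_E₁ (w : Amb n) : inner ℝ w (E₁ n) = w 0 := by
  simp [E₁, EuclideanSpace.inner_single_right]

theorem inner_E₁_left (w : Amb n) : inner ℝ (E₁ n) w = w 0 := by
  rw [real_inner_comm, inner_E₁]

theorem inner_Eₗ (w : Amb n) : inner ℝ w (Eₗ n) = height w := by
  simp [Eₗ, height, EuclideanSpace.inner_single_right]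

theorem norm_E₁ : ‖E₁ n‖ = 1 := by simp [E₁]

theorem E₁_zero : (E₁ n) 0 = 1 := by simp [E₁]

theorem Eₗ_zero [NeZero n] : (Eₗ n) 0 = 0 := by
  simp [Eₗ, NeZero.ne n]

theorem height_E₁ [NeZero n] : height (E₁ n) = 0 := by
  simp [E₁, height, NeZero.ne n]

theorem height_Eₗ : height (Eₗ n) = 1 := by simp [Eₗ, height]

theorem height_add (x y : Amb n) : height (x + y) = height x + height y := rfl

theorem height_sub (x y : Amb n) : height (x - y) = height x - height y := rfl

theorem height_smul (a : ℝ) (x : Amb n) : height (a • x) = a * height x := rfl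

theorem continuous_height : Continuous (height : Amb n → ℝ) := by
  unfold height; fun_prop

theorem continuous_apply_zero : Continuous fun x : Amb n => x 0 := by fun_prop

end Coordinates

/-! ### The radius of the cap through a point -/

section CapRadius

variable {n : ℕ}

/-- The radius of the `θ`-cap about the origin whose boundary sphere passes through `y`. -/
noncomputable def capRadius (θ : ℝ) (y : Amb n) : ℝ :=
  (Real.cos θ * y 0 + √(Real.cos θ ^ 2 * y 0 ^ 2 + Real.sin θ ^ 2 * ‖y‖ ^ 2)) / Real.sin θ ^ 2

theorem continuous_capRadius (θ : ℝ) : Continuous (capRadius θ : Amb n → ℝ) := by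
  unfold capRadius; fun_prop

theorem norm_sq_add_E₁ (y : Amb n) (a : ℝ) :
    ‖y + a • E₁ n‖ ^ 2 = ‖y‖ ^ 2 + 2 * a * y 0 + a ^ 2 := by
  rw [norm_add_sq_real, inner_smul_right, inner_E₁, norm_smul, norm_E₁, mul_one,
    Real.norm_eq_abs, sq_abs]
  ring

theorem abs_apply_zero_le (y : Amb n) : |y 0| ≤ ‖y‖ := by
  simpa using PiLp.norm_apply_le y 0

/-- Squared, the right side reads `sin² θ r² - 2 cos θ y₀ r - ‖y‖² ≥ 0`. The roots of this quadratic
in `r` have product at most `0`, and `capRadius` is the larger one. -/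
theorem capRadius_le_iff {θ r : ℝ} (hθ : 0 < Real.sin θ) (hr : 0 < r) (y : Amb n) :
    capRadius θ y ≤ r ↔ ‖y + (r * Real.cos θ) • E₁ n‖ ≤ r := by
  have hsc := Real.sin_sq_add_cos_sq θ
  rw [capRadius, div_le_iff₀ (by positivity), ← sq_le_sq₀ (norm_nonneg _) hr.le, norm_sq_add_E₁]
  have h1 : Real.cos θ * y 0 + √(Real.cos θ ^ 2 * y 0 ^ 2 + Real.sin θ ^ 2 * ‖y‖ ^ 2)
      ≤ r * Real.sin θ ^ 2 ↔ √(Real.cos θ ^ 2 * y 0 ^ 2 + Real.sin θ ^ 2 * ‖y‖ ^ 2)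
      ≤ r * Real.sin θ ^ 2 - Real.cos θ * y 0 := by constructor <;> intro h <;> linarith
  have h2 : 0 < Real.sin θ ^ 2 := by positivity
  rw [h1, Real.sqrt_le_iff]
  have h3 : (r * Real.cos θ) ^ 2 = r ^ 2 - r ^ 2 * Real.sin θ ^ 2 := by
    linear_combination r ^ 2 * hsc
  rw [h3]
  constructor
  · rintro ⟨-, h⟩
    have : Real.sin θ ^ 2 * (‖y‖ ^ 2 + 2 * (r * Real.cos θ) * y 0 - r ^ 2 * Real.sin θ ^ 2) ≤ 0 := by
      linarith
    linarith [nonpos_of_mul_nonpos_right this h2]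
  · intro h
    have h4 : ‖y‖ ^ 2 + 2 * (r * Real.cos θ) * y 0 - r ^ 2 * Real.sin θ ^ 2 ≤ 0 := by linarith
    have h5 := mul_nonpos_of_nonneg_of_nonpos h2.le h4
    refine ⟨?_, by linarith⟩
    -- If `r sin² θ < cos θ y₀`, the middle term of `h4` alone exceeds `r² sin² θ`.
    by_contra! h6
    have h7 : 0 < r * (Real.cos θ * y 0 - r * Real.sin θ ^ 2) := mul_pos hr (by linarith)
    have h8 : 0 < r ^ 2 * Real.sin θ ^ 2 := by positivity
    nlinarith [sq_nonneg ‖y‖]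

theorem capRadius_lt_iff {θ r : ℝ} (hθ : 0 < Real.sin θ) (hr : 0 < r) (y : Amb n) :
    capRadius θ y < r ↔ ‖y + (r * Real.cos θ) • E₁ n‖ < r := by
  have hsc := Real.sin_sq_add_cos_sq θ
  rw [capRadius, div_lt_iff₀ (by positivity), ← sq_lt_sq₀ (norm_nonneg _) hr.le, norm_sq_add_E₁]
  have h1 : Real.cos θ * y 0 + √(Real.cos θ ^ 2 * y 0 ^ 2 + Real.sin θ ^ 2 * ‖y‖ ^ 2)
      < r * Real.sin θ ^ 2 ↔ √(Real.cos θ ^ 2 * y 0 ^ 2 + Real.sin θ ^ 2 * ‖y‖ ^ 2)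
      < r * Real.sin θ ^ 2 - Real.cos θ * y 0 := by constructor <;> intro h <;> linarith
  have h2 : 0 < Real.sin θ ^ 2 := by positivity
  have h3 : (r * Real.cos θ) ^ 2 = r ^ 2 - r ^ 2 * Real.sin θ ^ 2 := by
    linear_combination r ^ 2 * hsc
  rw [h1, h3]
  constructor
  · intro h
    have h0 := (Real.sqrt_lt' ((Real.sqrt_nonneg _).trans_lt h)).1 h
    have : Real.sin θ ^ 2 * (‖y‖ ^ 2 + 2 * (r * Real.cos θ) * y 0 - r ^ 2 * Real.sin θ ^ 2) < 0 := by
      linarith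
    linarith [neg_of_mul_neg_right this h2.le]
  · intro h
    have h4 : ‖y‖ ^ 2 + 2 * (r * Real.cos θ) * y 0 - r ^ 2 * Real.sin θ ^ 2 < 0 := by linarith
    have h5 := mul_neg_of_pos_of_neg h2 h4
    refine (Real.sqrt_lt' ?_).2 (by linarith)
    by_contra! h6
    have h7 : 0 ≤ r * (Real.cos θ * y 0 - r * Real.sin θ ^ 2) := mul_nonneg hr.le (by linarith)
    have h8 : 0 < r ^ 2 * Real.sin θ ^ 2 := by positivity
    nlinarith [sq_nonneg ‖y‖]

theorem capRadius_pos {θ : ℝ} (hθ : 0 < Real.sin θ) {y : Amb n} (hy : y ≠ 0) :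
    0 < capRadius θ y := by
  unfold capRadius
  refine div_pos ?_ (by positivity)
  have h0 : 0 < ‖y‖ := norm_pos_iff.2 hy
  have h1 : |Real.cos θ * y 0|
      < √(Real.cos θ ^ 2 * y 0 ^ 2 + Real.sin θ ^ 2 * ‖y‖ ^ 2) := by
    apply Real.lt_sqrt_of_sq_lt
    rw [sq_abs, mul_pow]
    have : 0 < Real.sin θ ^ 2 * ‖y‖ ^ 2 := by positivity
    linarith
  linarith [neg_abs_le (Real.cos θ * y 0)]

theorem norm_add_capRadius {θ : ℝ} (hθ : 0 < Real.sin θ) {y : Amb n} (hy : 0 < capRadius θ y) :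
    ‖y + (capRadius θ y * Real.cos θ) • E₁ n‖ = capRadius θ y :=
  le_antisymm ((capRadius_le_iff hθ hy y).1 le_rfl)
    (not_lt.1 fun h => lt_irrefl _ ((capRadius_lt_iff hθ hy y).2 h))

/-- Homogeneity separates the radial function from the direction: `log (capRadius θ (e^u z)) = u +
log (capRadius θ z)`. -/
theorem capRadius_smul {θ a : ℝ} (ha : 0 ≤ a) (y : Amb n) :
    capRadius θ (a • y) = a * capRadius θ y := by
  have h : Real.cos θ ^ 2 * (a • y) 0 ^ 2 + Real.sin θ ^ 2 * ‖a • y‖ ^ 2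
      = a ^ 2 * (Real.cos θ ^ 2 * y 0 ^ 2 + Real.sin θ ^ 2 * ‖y‖ ^ 2) := by
    rw [norm_smul, Real.norm_eq_abs, mul_pow, sq_abs, PiLp.smul_apply, smul_eq_mul]
    ring
  rw [capRadius, capRadius, h, Real.sqrt_mul (sq_nonneg _), Real.sqrt_sq ha, PiLp.smul_apply,
    smul_eq_mul]
  ring

end CapRadius

/-! ### Calculus on the cone over the hemisphere -/

section Cone

variable {n : ℕ}

theorem isOpen_pos_apply_zero : IsOpen {y : Amb n | 0 < y 0} :=
  isOpen_lt continuous_const continuous_apply_zero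

theorem hemiCone_eq : hemiCone n = {y : Amb n | 0 ≤ y 0} ∩ {0}ᶜ := by
  ext y; simp [hemiCone, and_comm]

theorem pos_subset_interior_hemiCone : {y : Amb n | 0 < y 0} ⊆ interior (hemiCone n) := by
  refine interior_maximal (fun y (hy : 0 < y 0) => ⟨?_, hy.le⟩) isOpen_pos_apply_zero
  rintro rfl
  simp at hy

theorem uniqueDiffOn_hemiCone : UniqueDiffOn ℝ (hemiCone n) := by
  rw [hemiCone_eq]
  refine UniqueDiffOn.inter (uniqueDiffOn_convex ?_ ⟨E₁ n, ?_⟩) isOpen_compl_singleton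
  · intro x hx y hy a b ha hb _
    have hx : 0 ≤ x 0 := hx
    have hy : 0 ≤ y 0 := hy
    simp only [mem_ofPred_eq, PiLp.add_apply, PiLp.smul_apply, smul_eq_mul]
    positivity
  · refine interior_mono (s := {y : Amb n | 0 < y 0}) (fun y (hy : 0 < y 0) => hy.le) ?_
    rw [isOpen_pos_apply_zero.interior_eq]
    simp [E₁]

/-- This is the condition under which second derivatives within the cone are symmetric, also at its
boundary. -/
theorem mem_closure_interior_hemiCone {y : Amb n} (hy : y ∈ hemiCone n) :
    y ∈ closure (interior (hemiCone n)) := by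
  have h1 : Tendsto (fun s : ℝ => y + s • E₁ n) (𝓝[>] 0) (𝓝 y) := by
    have : ContinuousAt (fun s : ℝ => y + s • E₁ n) 0 := by fun_prop
    have := this.tendsto
    rw [zero_smul, add_zero] at this
    exact this.mono_left nhdsWithin_le_nhds
  refine mem_closure_of_tendsto h1 ?_
  filter_upwards [self_mem_nhdsWithin] with s hs
  have hs : 0 < s := hs
  apply pos_subset_interior_hemiCone
  have := hy.2
  simp only [mem_ofPred_eq, PiLp.add_apply, PiLp.smul_apply, smul_eq_mul, E₁_zero]
  linarith

theorem exists_segment_mem_hemiCone {y X : Amb n} (hy : y ∈ hemiCone n)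
    (hX : 0 < y 0 ∨ 0 ≤ X 0) : ∃ ε > 0, ∀ s ∈ Ico (0 : ℝ) ε, y + s • X ∈ hemiCone n := by
  have hc : Continuous fun s : ℝ => y + s • X := by fun_prop
  have h0 : ∀ᶠ s in 𝓝 (0 : ℝ), y + s • X ≠ 0 := by
    refine hc.continuousAt.eventually_ne ?_
    simpa using hy.1
  have h1 : ∀ᶠ s in 𝓝[≥] (0 : ℝ), y + s • X ∈ hemiCone n := by
    rcases hX with h | h
    · have h2 : ∀ᶠ s in 𝓝 (0 : ℝ), 0 < (y + s • X) 0 :=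
        hc.continuousAt.eventually_mem (isOpen_pos_apply_zero.mem_nhds (by simpa using h))
      filter_upwards [nhdsWithin_le_nhds h0, nhdsWithin_le_nhds h2] with s hs hs2
      exact ⟨hs, hs2.le⟩
    · filter_upwards [nhdsWithin_le_nhds h0, self_mem_nhdsWithin] with s hs hs2
      refine ⟨hs, ?_⟩
      have hs2 : 0 ≤ s := hs2
      have := hy.2
      simp only [PiLp.add_apply, PiLp.smul_apply, smul_eq_mul]
      positivity
  obtain ⟨ε, hε, h⟩ := mem_nhdsGE_iff_exists_Ico_subset.1 h1
  exact ⟨ε, hε, h⟩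

theorem radialExt_smul (u : Amb n → ℝ) {a : ℝ} (ha : 0 < a) (y : Amb n) :
    radialExt u (a • y) = radialExt u y := by
  unfold radialExt
  rw [norm_smul, Real.norm_eq_abs, abs_of_pos ha, smul_smul, mul_inv, mul_assoc,
    mul_comm ‖y‖⁻¹, ← mul_assoc, inv_mul_cancel₀ ha.ne', one_mul]

theorem radialExt_of_norm_eq_one (u : Amb n → ℝ) {z : Amb n} (hz : ‖z‖ = 1) :
    radialExt u z = u z := by simp [radialExt, hz]

theorem inner_sphGrad (u : Amb n → ℝ) (z X : Amb n) :
    inner ℝ (sphGrad u z) X = fderivWithin ℝ (radialExt u) (hemiCone n) z X := by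
  simp [sphGrad, gradientWithin]

variable {u : Amb n → ℝ}

/-- Euler's relation for a function homogeneous of degree `0`. -/
theorem fderivWithin_radialExt_self
    (hu : ContDiffOn ℝ 2 (radialExt u) (hemiCone n))
    {y : Amb n} (hy : y ∈ hemiCone n) :
    fderivWithin ℝ (radialExt u) (hemiCone n) y y = 0 := by
  have hd := (hu.differentiableOn (by norm_num) y hy).hasFDerivWithinAt
  have hl : HasDerivWithinAt (fun s : ℝ => y + s • y) y (Ici 0) 0 := by
    simpa using (((hasDerivAt_id (0 : ℝ)).smul_const y).const_add y).hasDerivWithinAt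
  have hmem : ∀ s ∈ Ici (0 : ℝ), y + s • y = (1 + s) • y := fun s _ => by
    rw [add_smul, one_smul]
  have hmaps : MapsTo (fun s : ℝ => y + s • y) (Ici 0) (hemiCone n) := by
    intro s hs
    have hs' : 0 ≤ s := hs
    show y + s • y ∈ _
    rw [hmem s hs]
    refine ⟨smul_ne_zero (by positivity) hy.1, ?_⟩
    have := hy.2
    simp only [PiLp.smul_apply, smul_eq_mul]
    positivity
  have h1 := HasFDerivWithinAt.comp_hasDerivWithinAt_of_eq (0 : ℝ) hd hl hmaps (by simp)
  have h2 : HasDerivWithinAt (radialExt u ∘ fun s : ℝ => y + s • y) 0 (Ici 0) 0 := by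
    refine (hasDerivWithinAt_const (0 : ℝ) (Ici 0) (radialExt u y)).congr ?_ (by simp)
    intro s hs
    have hs' : 0 ≤ s := hs
    simp only [Function.comp_apply, hmem s hs]
    exact radialExt_smul u (by positivity) y
  exact (uniqueDiffOn_Ici (0 : ℝ) 0 self_mem_Ici).eq_deriv _ h1 h2

theorem inner_sphGrad_self
    (hu : ContDiffOn ℝ 2 (radialExt u) (hemiCone n))
    {z : Amb n} (hz : z ∈ hemiCone n) : inner ℝ (sphGrad u z) z = 0 := by
  rw [inner_sphGrad, fderivWithin_radialExt_self hu hz]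

theorem hasFDerivWithinAt_fderivWithin_radialExt
    (hu : ContDiffOn ℝ 2 (radialExt u) (hemiCone n))
    {y : Amb n} (hy : y ∈ hemiCone n) :
    HasFDerivWithinAt (fderivWithin ℝ (radialExt u) (hemiCone n))
      (fderivWithin ℝ (fderivWithin ℝ (radialExt u) (hemiCone n)) (hemiCone n) y)
      (hemiCone n) y :=
  ((hu.fderivWithin uniqueDiffOn_hemiCone (m := 1) (by norm_num)).differentiableOn
    (by norm_num) y hy).hasFDerivWithinAt

/-- Differentiate Euler's relation `DF(y) y = 0` in the direction `X`. -/
theorem sphHess_self_right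
    (hu : ContDiffOn ℝ 2 (radialExt u) (hemiCone n))
    {z : Amb n} (hz : z ∈ hemiCone n) (X : Amb n) :
    sphHess u z X z = -inner ℝ (sphGrad u z) X := by
  have h1 := (hasFDerivWithinAt_fderivWithin_radialExt hu hz).clm_apply
    (hasFDerivWithinAt_id z (hemiCone n))
  have h2 : HasFDerivWithinAt
      (fun y => fderivWithin ℝ (radialExt u) (hemiCone n) y (id y)) 0 (hemiCone n) z :=
    (hasFDerivWithinAt_const (𝕜 := ℝ) (0 : ℝ) z (hemiCone n)).congr
      (fun y hy => fderivWithin_radialExt_self hu hy) (fderivWithin_radialExt_self hu hz)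
  have h3 := congrArg (fun L : Amb n →L[ℝ] ℝ => L X) ((uniqueDiffOn_hemiCone z hz).eq h1 h2)
  simp only [add_apply, ContinuousLinearMap.flip_apply,
    ContinuousLinearMap.comp_apply, ContinuousLinearMap.id_apply, id,
    zero_apply] at h3
  rw [inner_sphGrad, sphHess]
  linarith

theorem sphHess_comm
    (hu : ContDiffOn ℝ 2 (radialExt u) (hemiCone n))
    {z : Amb n} (hz : z ∈ hemiCone n) (X Y : Amb n) :
    sphHess u z X Y = sphHess u z Y X :=
  (hu z hz).isSymmSndFDerivWithinAt (by simp) uniqueDiffOn_hemiCone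
    (mem_closure_interior_hemiCone hz) hz X Y

theorem hasDerivWithinAt_radialExt_segment
    (hu : ContDiffOn ℝ 2 (radialExt u) (hemiCone n))
    {z X : Amb n} {ε : ℝ}
    (hmem : ∀ s ∈ Ico (0 : ℝ) ε, z + s • X ∈ hemiCone n) {s : ℝ} (hs : s ∈ Ico 0 ε) :
    HasDerivWithinAt (fun s : ℝ => radialExt u (z + s • X))
      (fderivWithin ℝ (radialExt u) (hemiCone n) (z + s • X) X) (Ico 0 ε) s := by
  have hl : HasDerivWithinAt (fun s : ℝ => z + s • X) X (Ico 0 ε) s := by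
    simpa using (((hasDerivAt_id s).smul_const X).const_add z).hasDerivWithinAt
  have hd := (hu.differentiableOn (by norm_num) _ (hmem s hs)).hasFDerivWithinAt
  exact HasFDerivWithinAt.comp_hasDerivWithinAt (l := radialExt u) s hd hl hmem

theorem hasDerivWithinAt_fderivWithin_radialExt_segment
    (hu : ContDiffOn ℝ 2 (radialExt u) (hemiCone n))
    {z X : Amb n} {ε : ℝ} (hε : 0 < ε)
    (hmem : ∀ s ∈ Ico (0 : ℝ) ε, z + s • X ∈ hemiCone n) :
    HasDerivWithinAt
      (fun s : ℝ => fderivWithin ℝ (radialExt u) (hemiCone n) (z + s • X) X)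
      (sphHess u z X X) (Ico 0 ε) 0 := by
  have hl : HasDerivWithinAt (fun s : ℝ => z + s • X) X (Ico 0 ε) 0 := by
    simpa using (((hasDerivAt_id (0 : ℝ)).smul_const X).const_add z).hasDerivWithinAt
  have hz : z ∈ hemiCone n := by simpa using hmem 0 ⟨le_rfl, hε⟩
  have h1 := HasFDerivWithinAt.comp_hasDerivWithinAt_of_eq (0 : ℝ)
    (hasFDerivWithinAt_fderivWithin_radialExt hu hz) hl hmem (by simp)
  refine (h1.clm_apply (hasDerivWithinAt_const (0 : ℝ) (Ico 0 ε) X)).congr_deriv ?_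
  simp [sphHess]

end Cone

/-! ### Extremal points along a ray -/

/-- First and second order conditions at `s = 0` for an extremum of
`r² + 2 a (z₀ + s X₀) τ - b τ²`, where `r² = 1 + 2 B s + A s²` and `τ = r e^{-F}`. -/
theorem segment_extremum {F F' : ℝ → ℝ} {ε A B z₀ X₀ a b h₂ ς : ℝ} (hε : 0 < ε)
    (hr : ∀ s ∈ Ico 0 ε, 0 < 1 + 2 * B * s + A * s ^ 2)
    (hF : ∀ s ∈ Ico 0 ε, HasDerivWithinAt F (F' s) (Ico 0 ε) s)
    (hF' : HasDerivWithinAt F' h₂ (Ico 0 ε) 0)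
    (hk : ∀ s ∈ Ico 0 ε, ς * ((1 + 2 * B * s + A * s ^ 2)
      + 2 * a * (z₀ + s * X₀) * (√(1 + 2 * B * s + A * s ^ 2) * Real.exp (-F s))
      - b * (√(1 + 2 * B * s + A * s ^ 2) * Real.exp (-F s)) ^ 2) ≤ 0)
    (hk0 : 1 + 2 * a * z₀ * Real.exp (-F 0) - b * Real.exp (-F 0) ^ 2 = 0) :
    ς * (B + a * X₀ * Real.exp (-F 0)
      + (a * z₀ - b * Real.exp (-F 0)) * Real.exp (-F 0) * (B - F' 0)) ≤ 0 ∧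
    (F' 0 = B → B + a * X₀ * Real.exp (-F 0) = 0 →
      ς * (A + (a * z₀ - b * Real.exp (-F 0)) * Real.exp (-F 0) * (A - 2 * B ^ 2 - h₂)) ≤ 0) := by
  set q : ℝ → ℝ := fun s => 1 + 2 * B * s + A * s ^ 2 with hq
  set r : ℝ → ℝ := fun s => √(q s) with hrdef
  set τ : ℝ → ℝ := fun s => r s * Real.exp (-F s) with hτ
  set τ' : ℝ → ℝ := fun s => ((B + A * s) / r s - r s * F' s) * Real.exp (-F s) with hτ'
  set k : ℝ → ℝ := fun s => ς * (q s + 2 * a * (z₀ + s * X₀) * τ s - b * τ s ^ 2) with hkdef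
  set k' : ℝ → ℝ := fun s =>
    ς * (2 * (B + A * s + a * X₀ * τ s + (a * (z₀ + s * X₀) - b * τ s) * τ' s)) with hk'
  have h0mem : (0 : ℝ) ∈ Ico 0 ε := ⟨le_rfl, hε⟩
  have hq0 : q 0 = 1 := by simp [hq]
  have hr0 : r 0 = 1 := by simp [hrdef, hq0]
  have hτ0 : τ 0 = Real.exp (-F 0) := by simp [hτ, hr0]
  have hqd : ∀ s, HasDerivAt q (2 * (B + A * s)) s := by
    intro s
    have h := (((hasDerivAt_id s).const_mul (2 * B)).const_add 1).add
      (((hasDerivAt_id s).pow 2).const_mul A)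
    refine (h.congr_deriv ?_)
    simp only [id]
    norm_num
    ring
  have hrd : ∀ s ∈ Ico 0 ε, HasDerivAt r ((B + A * s) / r s) s := by
    intro s hs
    refine ((hqd s).sqrt (hr s hs).ne').congr_deriv ?_
    rw [mul_div_mul_left _ _ two_ne_zero]
  have hrpos : ∀ s ∈ Ico 0 ε, 0 < r s := fun s hs => Real.sqrt_pos.2 (hr s hs)
  have hEd : ∀ s ∈ Ico 0 ε, HasDerivWithinAt (fun s => Real.exp (-F s))
      (Real.exp (-F s) * -F' s) (Ico 0 ε) s := fun s hs => (hF s hs).neg.exp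
  have hτd : ∀ s ∈ Ico 0 ε, HasDerivWithinAt τ (τ' s) (Ico 0 ε) s := by
    intro s hs
    refine ((hrd s hs).hasDerivWithinAt.mul (hEd s hs)).congr_deriv ?_
    simp only [hτ']
    ring
  have hld : ∀ s, HasDerivAt (fun s => z₀ + s * X₀) X₀ s := fun s => by
    simpa using ((hasDerivAt_id s).mul_const X₀).const_add z₀
  have hkd : ∀ s ∈ Ico 0 ε, HasDerivWithinAt k (k' s) (Ico 0 ε) s := by
    intro s hs
    refine ((((hqd s).hasDerivWithinAt.add
      (((hld s).const_mul (2 * a)).hasDerivWithinAt.mul (hτd s hs))).sub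
      (((hτd s hs).pow 2).const_mul b)).const_mul ς).congr_deriv ?_
    simp only [hk', Nat.cast_ofNat, Nat.add_one_sub_one, pow_one]
    ring
  have hmax : ∀ s ∈ Ico 0 ε, k s ≤ k 0 := by
    intro s hs
    have h1 : k 0 = 0 := by
      simp only [hkdef, hτ0, hq0]
      rw [zero_mul, add_zero, hk0, mul_zero]
    rw [h1]
    exact hk s hs
  have hnhds : Ico 0 ε ∈ 𝓝[≥] (0 : ℝ) := Ico_mem_nhdsGE hε
  refine ⟨?_, fun hB hX => ?_⟩
  · have h1 := deriv_right_nonpos_of_le ((hkd 0 h0mem).mono_of_mem_nhdsWithin hnhds)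
      (by filter_upwards [Ioo_mem_nhdsGT hε] with s hs using hmax s ⟨hs.1.le, hs.2⟩)
    simp only [hk', hτ', hτ0, hr0] at h1
    norm_num at h1
    linarith
  -- The two side conditions make both `τ'` and `k'` vanish at `0`, so the limit of `k' s / s` is
  -- the derivative of `k'` at `0`. This uses differentiability of `F'` at the single point `0`
  -- only.
  · have hτ'0 : τ' 0 = 0 := by simp [hτ', hr0, hB]
    have hk'0 : k' 0 = 0 := by
      simp only [hk', hτ'0, hτ0, mul_zero, add_zero, hX]
    have hBd : HasDerivAt (fun s : ℝ => B + A * s) A 0 := by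
      simpa using ((hasDerivAt_id (0 : ℝ)).const_mul A).const_add B
    have hτ'd : HasDerivWithinAt τ' (Real.exp (-F 0) * (A - 2 * B ^ 2 - h₂)) (Ico 0 ε) 0 := by
      refine ((((hBd.div (hrd 0 h0mem) (hrpos 0 h0mem).ne').hasDerivWithinAt).sub
        ((hrd 0 h0mem).hasDerivWithinAt.mul hF')).mul (hEd 0 h0mem)).congr_deriv ?_
      simp only [Pi.sub_apply, Pi.mul_apply, Pi.div_apply, hr0, hB]
      norm_num
      ring
    have hk'd : HasDerivWithinAt k' (ς * (2 * (A + (a * z₀ - b * Real.exp (-F 0))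
        * (Real.exp (-F 0) * (A - 2 * B ^ 2 - h₂))))) (Ico 0 ε) 0 := by
      refine ((((hBd.hasDerivWithinAt.add ((hτd 0 h0mem).const_mul (a * X₀))).add
        ((((hld 0).const_mul a).hasDerivWithinAt.sub ((hτd 0 h0mem).const_mul b)).mul
          hτ'd)).const_mul 2).const_mul ς).congr_deriv ?_
      simp only [hτ'0, hτ0, Pi.sub_apply]
      ring
    have hlim : Tendsto (fun s => k' s / s) (𝓝[>] 0) (𝓝 (ς * (2 * (A
        + (a * z₀ - b * Real.exp (-F 0)) * (Real.exp (-F 0) * (A - 2 * B ^ 2 - h₂)))))) := by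
      have h1 := (hasDerivWithinAt_iff_tendsto_slope' (by simp)).1
        ((hk'd.mono_of_mem_nhdsWithin hnhds).mono Ioi_subset_Ici_self)
      refine h1.congr fun s => ?_
      rw [slope_def_field, hk'0, sub_zero, sub_zero]
    have h2 := nonpos_of_tendsto_deriv_div hε hkd hmax hlim
    linarith

/-! ### The scalar equation at a spatial extremum -/

section ScalarExtremum

variable {n : ℕ}

/-- The trace over the orthogonal complement of `w`, computed with the projections of the
standard basis. -/
theorem sum_bilin_projection {β : Amb n → Amb n → ℝ} {w : Amb n} {v : ℝ} (hv : v ≠ 0)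
    (hw : ‖w‖ ^ 2 = v ^ 2)
    (hβl : ∀ (a : ℝ) X Y Z, β (X - a • Y) Z = β X Z - a * β Y Z)
    (hβr : ∀ (a : ℝ) X Y Z, β Z (X - a • Y) = β Z X - a * β Z Y)
    (hl : ∑ i, w i * β (EuclideanSpace.single i 1) w = β w w)
    (hr : ∑ i, w i * β w (EuclideanSpace.single i 1) = β w w) :
    ∑ i, β (EuclideanSpace.single i 1 - (w i / v ^ 2) • w)
        (EuclideanSpace.single i 1 - (w i / v ^ 2) • w)
      = ∑ i, β (EuclideanSpace.single i 1) (EuclideanSpace.single i 1) - β w w / v ^ 2 := by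
  have hw2 : ∑ i, w i * w i = v ^ 2 := by
    rw [← hw, EuclideanSpace.norm_sq_eq]
    simp [sq]
  have h : ∀ i, β (EuclideanSpace.single i 1 - (w i / v ^ 2) • w)
      (EuclideanSpace.single i 1 - (w i / v ^ 2) • w)
      = β (EuclideanSpace.single i 1) (EuclideanSpace.single i 1)
        - (w i * β (EuclideanSpace.single i 1) w) * (v ^ 2)⁻¹
        - (w i * β w (EuclideanSpace.single i 1)) * (v ^ 2)⁻¹
        + (w i * w i) * ((v ^ 2)⁻¹ * (v ^ 2)⁻¹ * β w w) := by
    intro i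
    rw [hβl, hβr, hβr]
    ring
  rw [Finset.sum_congr rfl fun i _ => h i, Finset.sum_add_distrib, Finset.sum_sub_distrib,
    Finset.sum_sub_distrib, ← Finset.sum_mul, ← Finset.sum_mul, ← Finset.sum_mul, hl, hr, hw2]
  field_simp
  ring

theorem sum_single_eq {ι : Type*} [Fintype ι] [DecidableEq ι] (w : EuclideanSpace ℝ ι) :
    ∑ i, w i • (EuclideanSpace.single i (1 : ℝ)) = w := by
  ext j
  simp [Pi.single_apply]

theorem sum_clm_single (L : Amb n →L[ℝ] ℝ) (w : Amb n) :
    ∑ i, w i * L (EuclideanSpace.single i 1) = L w := by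
  conv_rhs => rw [← sum_single_eq w, map_sum]
  simp

/-- If `z`, `w` satisfy the first order conditions at an extremum, then the normals agree. -/
theorem smul_add_E₁_eq {θ m ρ v c₀ : ℝ} {z w : Amb n} (hθ : 0 < Real.sin θ) (hm : 0 < m)
    (hρ : 0 < ρ) (hv : 0 < v) (hw : ‖w‖ = v) (hz : ‖z‖ = 1)
    (hY : ‖ρ • z + (m * Real.cos θ) • E₁ n‖ = m)
    (hc₀ : c₀ = m * Real.cos θ * z 0 - m ^ 2 * Real.sin θ ^ 2 / ρ)
    (hint : 0 < z 0 → ρ • z + (m * Real.cos θ) • E₁ n = -c₀ • w)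
    (hbdry : z 0 = 0 → w 0 = v * Real.cos θ ∧
      ∃ ζ : ℝ, ρ • z + (m * Real.cos θ) • E₁ n = -c₀ • w + ζ • E₁ n)
    (hz0 : 0 ≤ z 0) :
    ρ • z + (m * Real.cos θ) • E₁ n = (m / v) • w ∧ -c₀ = m / v := by
  have hsc := Real.sin_sq_add_cos_sq θ
  have hsq : ρ ^ 2 + 2 * (m * Real.cos θ) * (ρ * z 0) = m ^ 2 * Real.sin θ ^ 2 := by
    have h := norm_sq_add_E₁ (ρ • z) (m * Real.cos θ)
    rw [hY, norm_smul, hz, Real.norm_eq_abs, mul_one, sq_abs, PiLp.smul_apply, smul_eq_mul] at h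
    linear_combination -h - m ^ 2 * hsc
  -- Eliminating `z 0` through the cap equation makes the sign of `c₀` visible.
  have hc₀' : -c₀ = (ρ ^ 2 + m ^ 2 * Real.sin θ ^ 2) / (2 * ρ) := by
    rw [hc₀]
    field_simp
    linear_combination -hsq
  have hneg : 0 < -c₀ := by rw [hc₀']; positivity
  have hval : ρ • z + (m * Real.cos θ) • E₁ n = -c₀ • w → -c₀ = m / v := by
    intro h
    rw [h, norm_smul, hw, Real.norm_eq_abs, abs_of_pos hneg] at hY
    rw [← hY]
    field_simp
  have hmain : ρ • z + (m * Real.cos θ) • E₁ n = -c₀ • w := by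
    rcases hz0.eq_or_lt with h0 | h0
    -- On the boundary the first order conditions leave a multiple `ζ` of `E₁` undetermined. The
    -- contact angle and a comparison of lengths give `(sin θ v)² = 1`; positivity selects `sin θ v
    -- = 1`, and then `ζ = 0`.
    · obtain ⟨hw0, ζ, hζ⟩ := hbdry h0.symm
      rw [← h0, mul_zero, mul_zero, add_zero] at hsq
      have hρm : ρ = m * Real.sin θ := by
        rw [← mul_pow] at hsq
        exact (sq_eq_sq₀ hρ.le (by positivity)).1 hsq
      have hc1 : -c₀ = ρ := by
        rw [hc₀', ← hsq]
        field_simp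
        ring
      rw [hc1] at hζ ⊢
      have h1 : m * Real.cos θ = ρ * (v * Real.cos θ) + ζ := by
        have := congrArg (fun y : Amb n => y 0) hζ
        simpa [← h0, E₁_zero, hw0] using this
      have h2 : m ^ 2 = ρ ^ 2 * v ^ 2 + 2 * ζ * (ρ * (v * Real.cos θ)) + ζ ^ 2 := by
        have := norm_sq_add_E₁ (ρ • w) ζ
        rw [← hζ, hY, norm_smul, hw, Real.norm_eq_abs, abs_of_pos hρ, PiLp.smul_apply,
          smul_eq_mul, hw0] at this
        linear_combination this
      have h3 : ζ = m * Real.cos θ * (1 - Real.sin θ * v) := by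
        rw [hρm] at h1
        linear_combination -h1
      have h4 : Real.sin θ * v = 1 := by
        have h5 : m ^ 2 * Real.sin θ ^ 2 * ((Real.sin θ * v) ^ 2 - 1) = 0 := by
          rw [hρm, h3] at h2
          linear_combination -h2 + (m ^ 2 * (Real.sin θ * v) ^ 2 - m ^ 2) * hsc
        have h6 : (Real.sin θ * v) ^ 2 - 1 = 0 := by
          rcases mul_eq_zero.1 h5 with h | h
          · exact absurd h (by positivity)
          · exact h
        have h7 : 0 < Real.sin θ * v := by positivity
        nlinarith
      rw [hζ, h3, h4, sub_self, mul_zero, zero_smul, add_zero]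
    · exact hint h0
  refine ⟨?_, hval hmain⟩
  rw [← hval hmain, hmain]

theorem hemisphere_subset_hemiCone : hemisphere n ⊆ hemiCone n := fun z hz =>
  ⟨by rintro rfl; simpa [hemisphere] using hz.1, hz.2⟩

theorem normalize_mem_hemisphere {y : Amb n} (hy : y ∈ hemiCone n) :
    ‖y‖⁻¹ • y ∈ hemisphere n := by
  have h : 0 < ‖y‖ := norm_pos_iff.2 hy.1
  refine ⟨?_, ?_⟩
  · rw [norm_smul, norm_inv, norm_norm, inv_mul_cancel₀ h.ne']
  · have := hy.2
    simp only [PiLp.smul_apply, smul_eq_mul]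
    positivity

/-- The comparison of a radial graph with a cap, in terms of `τ = |y| e^{-u}` on the cone. -/
theorem cone_comparison {θ m ς : ℝ} {u : Amb n → ℝ}
    (hext : ∀ z ∈ hemisphere n,
      ς * (‖Real.exp (u z) • z + (m * Real.cos θ) • E₁ n‖ ^ 2 - m ^ 2) ≤ 0)
    {y : Amb n} (hy : y ∈ hemiCone n) :
    ς * (‖y‖ ^ 2 + 2 * (m * Real.cos θ) * y 0 * (‖y‖ * Real.exp (-radialExt u y))
      - m ^ 2 * Real.sin θ ^ 2 * (‖y‖ * Real.exp (-radialExt u y)) ^ 2) ≤ 0 := by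
  have hsc := Real.sin_sq_add_cos_sq θ
  have h0 : 0 < ‖y‖ := norm_pos_iff.2 hy.1
  have hz := normalize_mem_hemisphere hy
  have h := hext _ hz
  rw [norm_sq_add_E₁, norm_smul, hz.1, mul_one, Real.norm_eq_abs, sq_abs] at h
  have hE : Real.exp (radialExt u y) * Real.exp (-radialExt u y) = 1 := by
    rw [← Real.exp_add, add_neg_cancel, Real.exp_zero]
  have hu : u (‖y‖⁻¹ • y) = radialExt u y := rfl
  rw [hu] at h
  simp only [PiLp.smul_apply, smul_eq_mul] at h
  set e := Real.exp (radialExt u y)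
  set d := Real.exp (-radialExt u y)
  -- Multiplication by `τ² = (‖y‖ e^{-u})²` keeps the sign and removes the normalisation of `y`,
  -- leaving a polynomial in `y` and `τ` that can be differentiated along straight segments.
  have h1 : ς * (e ^ 2 + 2 * (m * Real.cos θ) * (e * (‖y‖⁻¹ * y 0)) + (m * Real.cos θ) ^ 2
      - m ^ 2) * (‖y‖ * d) ^ 2 ≤ 0 := mul_nonpos_of_nonpos_of_nonneg h (sq_nonneg _)
  refine le_trans (le_of_eq ?_) h1
  have h2 : ‖y‖ * ‖y‖⁻¹ = 1 := mul_inv_cancel₀ h0.ne'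
  have h3 : (e ^ 2 + 2 * (m * Real.cos θ) * (e * (‖y‖⁻¹ * y 0)) + (m * Real.cos θ) ^ 2
      - m ^ 2) * (‖y‖ * d) ^ 2 = (e * d) ^ 2 * ‖y‖ ^ 2
      + 2 * (m * Real.cos θ) * (e * d) * (‖y‖ * ‖y‖⁻¹) * y 0 * (‖y‖ * d)
      + m ^ 2 * (Real.cos θ ^ 2 - 1) * (‖y‖ * d) ^ 2 := by ring
  rw [mul_assoc ς, h3, hE, h2]
  linear_combination -ς * m ^ 2 * (‖y‖ * d) ^ 2 * hsc

variable {θ m ς : ℝ} {u : Amb n → ℝ} {z : Amb n}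

/-- First and second order conditions in an admissible direction `X`. -/
theorem direction_conditions (hu : ContDiffOn ℝ 2 (radialExt u) (hemiCone n))
    (hz : z ∈ hemisphere n)
    (hext : ∀ y ∈ hemisphere n,
      ς * (‖Real.exp (u y) • y + (m * Real.cos θ) • E₁ n‖ ^ 2 - m ^ 2) ≤ 0)
    (heq : ‖Real.exp (u z) • z + (m * Real.cos θ) • E₁ n‖ ^ 2 = m ^ 2)
    {X : Amb n} (hX : 0 < z 0 ∨ 0 ≤ X 0) :
    ς * (inner ℝ z X + m * Real.cos θ * X 0 * Real.exp (-u z)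
      + (m * Real.cos θ * z 0 - m ^ 2 * Real.sin θ ^ 2 * Real.exp (-u z)) * Real.exp (-u z)
        * (inner ℝ z X - inner ℝ (sphGrad u z) X)) ≤ 0 ∧
    (inner ℝ (sphGrad u z) X = inner ℝ z X →
      inner ℝ z X + m * Real.cos θ * X 0 * Real.exp (-u z) = 0 →
      ς * (‖X‖ ^ 2 + (m * Real.cos θ * z 0 - m ^ 2 * Real.sin θ ^ 2 * Real.exp (-u z))
        * Real.exp (-u z) * (‖X‖ ^ 2 - 2 * inner ℝ z X ^ 2 - sphHess u z X X)) ≤ 0) := by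
  have hzC := hemisphere_subset_hemiCone hz
  obtain ⟨ε, hε, hmem⟩ := exists_segment_mem_hemiCone hzC hX
  have hnsq : ∀ s : ℝ, ‖z + s • X‖ ^ 2 = 1 + 2 * inner ℝ z X * s + ‖X‖ ^ 2 * s ^ 2 := by
    intro s
    rw [norm_add_sq_real, hz.1, inner_smul_right, norm_smul, mul_pow, Real.norm_eq_abs, sq_abs]
    ring
  have hn : ∀ s : ℝ, √(1 + 2 * inner ℝ z X * s + ‖X‖ ^ 2 * s ^ 2) = ‖z + s • X‖ := fun s => by
    rw [← hnsq, Real.sqrt_sq (norm_nonneg _)]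
  have hF0 : radialExt u (z + (0 : ℝ) • X) = u z := by
    rw [zero_smul, add_zero, radialExt_of_norm_eq_one u hz.1]
  have hk0 : 1 + 2 * (m * Real.cos θ) * z 0 * Real.exp (-radialExt u (z + (0 : ℝ) • X))
      - m ^ 2 * Real.sin θ ^ 2 * Real.exp (-radialExt u (z + (0 : ℝ) • X)) ^ 2 = 0 := by
    rw [hF0]
    have hE : Real.exp (u z) * Real.exp (-u z) = 1 := by
      rw [← Real.exp_add, add_neg_cancel, Real.exp_zero]
    rw [norm_sq_add_E₁, norm_smul, hz.1, mul_one, Real.norm_eq_abs, sq_abs, PiLp.smul_apply,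
      smul_eq_mul] at heq
    have hsc := Real.sin_sq_add_cos_sq θ
    set e := Real.exp (u z)
    set d := Real.exp (-u z)
    linear_combination d ^ 2 * heq - m ^ 2 * d ^ 2 * hsc - (e * d + 1
      + 2 * (m * Real.cos θ) * z 0 * d) * hE
  have h := segment_extremum (A := ‖X‖ ^ 2) (B := inner ℝ z X) (z₀ := z 0) (X₀ := X 0)
    (a := m * Real.cos θ) (b := m ^ 2 * Real.sin θ ^ 2) (ς := ς) hε
    (fun s hs => by
      rw [← hnsq]
      have := norm_pos_iff.2 (hmem s hs).1
      positivity)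
    (fun s hs => hasDerivWithinAt_radialExt_segment hu hmem hs)
    (hasDerivWithinAt_fderivWithin_radialExt_segment hu hε hmem)
    (fun s hs => by
      have := cone_comparison hext (hmem s hs)
      rw [hn, ← hnsq]
      simpa using this) hk0
  rw [hF0, zero_smul, add_zero, ← inner_sphGrad] at h
  exact h

theorem norm_sub_sphGrad (hu : ContDiffOn ℝ 2 (radialExt u) (hemiCone n))
    (hz : z ∈ hemisphere n) : ‖z - sphGrad u z‖ = slope u z := by
  have h : ‖z - sphGrad u z‖ ^ 2 = 1 + ‖sphGrad u z‖ ^ 2 := by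
    rw [norm_sub_sq_real, hz.1, real_inner_comm,
      inner_sphGrad_self hu (hemisphere_subset_hemiCone hz)]
    ring
  rw [slope, ← h, Real.sqrt_sq (norm_nonneg _)]

theorem slope_pos (u : Amb n → ℝ) (z : Amb n) : 0 < slope u z :=
  Real.sqrt_pos.2 (by positivity)

/-- At an extremum the normal of the graph is the normal of the cap. -/
theorem normal_eq_at_extremum (hθ : 0 < Real.sin θ) (hm : 0 < m) (hς : ς ≠ 0)
    (hu : ContDiffOn ℝ 2 (radialExt u) (hemiCone n)) (hz : z ∈ hemisphere n)
    (hext : ∀ y ∈ hemisphere n,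
      ς * (‖Real.exp (u y) • y + (m * Real.cos θ) • E₁ n‖ ^ 2 - m ^ 2) ≤ 0)
    (heq : ‖Real.exp (u z) • z + (m * Real.cos θ) • E₁ n‖ = m)
    (hbdry : z 0 = 0 → inner ℝ (sphGrad u z) (-E₁ n) = slope u z * Real.cos θ) :
    Real.exp (u z) • z + (m * Real.cos θ) • E₁ n = (m / slope u z) • (z - sphGrad u z) ∧
    -(m * Real.cos θ * z 0 - m ^ 2 * Real.sin θ ^ 2 / Real.exp (u z)) = m / slope u z := by
  have hρ := Real.exp_pos (u z)
  have hρ' : Real.exp (-u z) = (Real.exp (u z))⁻¹ := Real.exp_neg _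
  set c₀ := m * Real.cos θ * z 0 - m ^ 2 * Real.sin θ ^ 2 / Real.exp (u z) with hc₀
  have heq2 : ‖Real.exp (u z) • z + (m * Real.cos θ) • E₁ n‖ ^ 2 = m ^ 2 := by rw [heq]
  set Z : Amb n := Real.exp (u z) • z + (m * Real.cos θ) • E₁ n + c₀ • (z - sphGrad u z) with hZ
  have hfirst : ∀ X : Amb n, (0 < z 0 ∨ 0 ≤ X 0) → ς * inner ℝ Z X ≤ 0 := by
    intro X hX
    have h := (direction_conditions hu hz hext heq2 hX).1
    simp only [hρ', ← div_eq_mul_inv, ← hc₀] at h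
    have h2 := mul_nonpos_of_nonpos_of_nonneg h hρ.le
    refine le_trans (le_of_eq ?_) h2
    rw [hZ, inner_add_left, inner_add_left, inner_smul_left, inner_smul_left, inner_smul_left,
      inner_sub_left, inner_E₁_left]
    simp only [conj_trivial]
    field_simp
  -- For such `X` both `X` and `-X` are admissible, so the one-sided inequality becomes an equality.
  have hzero : ∀ X : Amb n, (0 < z 0 ∨ X 0 = 0) → inner ℝ Z X = 0 := by
    intro X hX
    have h1 := hfirst X (hX.imp_right fun h => h.ge)
    have h2 := hfirst (-X) (hX.imp_right fun h => by simp [h])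
    rw [inner_neg_right] at h2
    have h3 : ς * inner ℝ Z X = 0 := by linarith
    exact (mul_eq_zero.1 h3).resolve_left hς
  refine smul_add_E₁_eq hθ hm hρ (slope_pos u z) (norm_sub_sphGrad hu hz) hz.1 heq rfl ?_ ?_ hz.2
  · intro h0
    have h1 : Z = 0 := inner_self_eq_zero.1 (hzero Z (Or.inl h0))
    rw [neg_smul]
    exact eq_neg_of_add_eq_zero_left h1
  · intro h0
    refine ⟨?_, Z 0, ?_⟩
    · have := hbdry h0
      rw [inner_neg_right, inner_E₁] at this
      rw [PiLp.sub_apply, h0, zero_sub, this]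
    · have h1 : Z - Z 0 • E₁ n = 0 := by
        have h2 : (Z - Z 0 • E₁ n) 0 = 0 := by simp [E₁_zero]
        have h3 := hzero _ (Or.inr h2)
        refine (inner_self_eq_zero (𝕜 := ℝ)).1 ?_
        rw [inner_sub_left, h3, inner_smul_left, inner_E₁_left, h2]
        simp
      rw [sub_eq_zero] at h1
      rw [← h1, hZ]
      module

/-- The second order condition is summed over the projections of the standard basis to the
orthogonal complement of `w = z - ∇u`, that is, traced over the common tangent space of the graph
and the cap. The terms `2 ⟨z, X⟩²` cancel against the radial part of the Hessian, and
`graphContraction` remains. -/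
theorem contraction_at_extremum (hθ : 0 < Real.sin θ) (hm : 0 < m) (hς : ς ≠ 0)
    (hu : ContDiffOn ℝ 2 (radialExt u) (hemiCone n)) (hz : z ∈ hemisphere n)
    (hext : ∀ y ∈ hemisphere n,
      ς * (‖Real.exp (u y) • y + (m * Real.cos θ) • E₁ n‖ ^ 2 - m ^ 2) ≤ 0)
    (heq : ‖Real.exp (u z) • z + (m * Real.cos θ) • E₁ n‖ = m)
    (hbdry : z 0 = 0 → inner ℝ (sphGrad u z) (-E₁ n) = slope u z * Real.cos θ) :
    ς * (n - m / slope u z / Real.exp (u z) * (n - graphContraction u z)) ≤ 0 := by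
  obtain ⟨hN, hc⟩ := normal_eq_at_extremum hθ hm hς hu hz hext heq hbdry
  have hzC := hemisphere_subset_hemiCone hz
  have hρ := Real.exp_pos (u z)
  have hρ' : Real.exp (-u z) = (Real.exp (u z))⁻¹ := Real.exp_neg _
  have hv := slope_pos u z
  have hw := norm_sub_sphGrad hu hz
  have heq2 : ‖Real.exp (u z) • z + (m * Real.cos θ) • E₁ n‖ ^ 2 = m ^ 2 := by rw [heq]
  set g := sphGrad u z with hg
  set w := z - g with hwdef
  set v := slope u z with hvdef
  have hw2 : ‖w‖ ^ 2 = v ^ 2 := by rw [hw]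
  have hgz : inner ℝ g z = 0 := inner_sphGrad_self hu hzC
  have hzw : inner ℝ z w = (1 : ℝ) := by
    rw [hwdef, inner_sub_right, real_inner_comm g z, hgz, real_inner_self_eq_norm_sq, hz.1]
    norm_num
  have hsecond : ∀ X : Amb n, inner ℝ w X = 0 → ς * (‖X‖ ^ 2
      - m / v / Real.exp (u z) * (‖X‖ ^ 2 - 2 * inner ℝ z X ^ 2 - sphHess u z X X)) ≤ 0 := by
    have haux : ∀ X : Amb n, 0 ≤ X 0 → inner ℝ w X = 0 → ς * (‖X‖ ^ 2
        - m / v / Real.exp (u z) * (‖X‖ ^ 2 - 2 * inner ℝ z X ^ 2 - sphHess u z X X)) ≤ 0 := by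
      intro X hX0 hX
      have h := (direction_conditions hu hz hext heq2 (Or.inr hX0)).2
      have h1 : inner ℝ g X = inner ℝ z X := by
        rw [hwdef, inner_sub_left] at hX
        linarith
      have h2 : inner ℝ z X + m * Real.cos θ * X 0 * Real.exp (-u z) = 0 := by
        have := congrArg (fun Y : Amb n => inner ℝ Y X) hN
        simp only [inner_add_left, inner_smul_left, conj_trivial, inner_E₁_left, hX,
          mul_zero] at this
        rw [hρ']
        field_simp
        linarith
      have h3 := h h1 h2
      rw [hρ', ← div_eq_mul_inv, ← div_eq_mul_inv,
        show m * Real.cos θ * z 0 - m ^ 2 * Real.sin θ ^ 2 / Real.exp (u z) = -(m / v) by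
          linarith] at h3
      refine le_trans (le_of_eq ?_) h3
      ring
    intro X hX
    -- The expression is even in `X`, and one of `±X` is admissible even at a boundary point.
    rcases le_total 0 (X 0) with h0 | h0
    · exact haux X h0 hX
    · have h := haux (-X) (by simpa using h0) (by rw [inner_neg_right, hX, neg_zero])
      simpa [sphHess, inner_neg_right] using h
  have horth : ∀ i : Fin (n + 1),
      inner ℝ w (EuclideanSpace.single i (1 : ℝ) - (w i / v ^ 2) • w) = 0 := by
    intro i
    rw [inner_sub_right, inner_smul_right, real_inner_self_eq_norm_sq, hw2,
      EuclideanSpace.inner_single_right]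
    simp
    field_simp
    ring
  have hsum := Finset.sum_nonpos fun i (_ : i ∈ Finset.univ) => hsecond _ (horth i)
  rw [← Finset.mul_sum, Finset.sum_sub_distrib, ← Finset.mul_sum, Finset.sum_sub_distrib,
    Finset.sum_sub_distrib, ← Finset.mul_sum] at hsum
  have hS1 : ∑ i : Fin (n + 1), ‖EuclideanSpace.single i (1 : ℝ) - (w i / v ^ 2) • w‖ ^ 2 = n := by
    have h := sum_bilin_projection (β := fun X Y => inner ℝ X Y) (w := w) hv.ne' hw2
      (by intro a X Y Z; simp [inner_sub_left, inner_smul_left])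
      (by intro a X Y Z; simp [inner_sub_right, inner_smul_right])
      (by simpa [real_inner_comm] using sum_clm_single (innerSL ℝ w) w)
      (sum_clm_single (innerSL ℝ w) w)
    simp only [real_inner_self_eq_norm_sq] at h
    rw [h, hw2]
    simp [hv.ne']
  have hS2 : ∑ i : Fin (n + 1), inner ℝ z (EuclideanSpace.single i (1 : ℝ) - (w i / v ^ 2) • w) ^ 2
      = 1 - 1 / v ^ 2 := by
    have h := sum_bilin_projection (β := fun X Y => inner ℝ z X * inner ℝ z Y) (w := w) hv.ne' hw2
      (by intro a X Y Z; simp [inner_sub_right, inner_smul_right]; ring)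
      (by intro a X Y Z; simp [inner_sub_right, inner_smul_right]; ring)
      (by simpa [Finset.sum_mul, mul_assoc] using
            congrArg (fun r => r * inner ℝ z w) (sum_clm_single (innerSL ℝ z) w))
      (by simpa [Finset.mul_sum, mul_left_comm] using
            congrArg (fun r => inner ℝ z w * r) (sum_clm_single (innerSL ℝ z) w))
    simp only [← sq] at h
    rw [h, hzw, one_pow]
    congr 1
    have := EuclideanSpace.norm_sq_eq z
    rw [hz.1] at this
    simpa [EuclideanSpace.inner_single_right] using this.symm
  have hS3 : ∑ i : Fin (n + 1), sphHess u z (EuclideanSpace.single i 1 - (w i / v ^ 2) • w)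
      (EuclideanSpace.single i 1 - (w i / v ^ 2) • w)
      = sphLap u z - (2 * (v ^ 2 - 1) + sphHess u z g g) / v ^ 2 := by
    have h := sum_bilin_projection (β := sphHess u z) (w := w) hv.ne' hw2
      (by intro a X Y Z; simp [sphHess])
      (by intro a X Y Z; simp [sphHess])
      (by
        simp only [sphHess_comm hu hzC _ w]
        exact sum_clm_single (fderivWithin ℝ (fderivWithin ℝ (radialExt u) (hemiCone n))
          (hemiCone n) z w) w)
      (sum_clm_single (fderivWithin ℝ (fderivWithin ℝ (radialExt u) (hemiCone n))
          (hemiCone n) z w) w)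
    have hg2 : ‖g‖ ^ 2 = v ^ 2 - 1 := by
      rw [← hw2, hwdef, norm_sub_sq_real, hz.1, real_inner_comm, hgz]
      ring
    -- The radial entries of the Hessian of the extension are `Hess(z, z) = 0` and `Hess(g, z) =
    -- -|g|²`.
    have hww : sphHess u z w w = 2 * (v ^ 2 - 1) + sphHess u z g g := by
      have h1 : sphHess u z w w
          = sphHess u z z z - sphHess u z g z - sphHess u z z g + sphHess u z g g := by
        simp only [hwdef, sphHess, map_sub, sub_apply]
        ring
      rw [h1, sphHess_comm hu hzC z g, sphHess_self_right hu hzC, sphHess_self_right hu hzC,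
        ← hg, hgz, real_inner_self_eq_norm_sq, hg2]
      ring
    rw [h, hww, sphLap]
  rw [hS1, hS2, hS3] at hsum
  refine le_trans (le_of_eq ?_) hsum
  rw [graphContraction, ← hg, ← hvdef]
  field_simp
  ring

/-- Since the unit normals agree, the height and `cos θ N₀` in `q_c` are expressed through the
contact cap. What is left of `q_c` is a positive multiple of the quantity bounded in
`contraction_at_extremum`. -/
theorem scalarRHS_at_extremum [NeZero n] {c : ℝ} (hθ : 0 < Real.sin θ) (hm : 0 < m) (hς : ς ≠ 0)
    (hu : ContDiffOn ℝ 2 (radialExt u) (hemiCone n)) (hz : z ∈ hemisphere n)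
    (hH : graphPoint c u z ∈ Hyp n)
    (hext : ∀ y ∈ hemisphere n,
      ς * (‖Real.exp (u y) • y + (m * Real.cos θ) • E₁ n‖ ^ 2 - m ^ 2) ≤ 0)
    (heq : ‖Real.exp (u z) • z + (m * Real.cos θ) • E₁ n‖ = m)
    (hbdry : z 0 = 0 → inner ℝ (sphGrad u z) (-E₁ n) = slope u z * Real.cos θ) :
    ς * scalarRHS c θ u z ≤ 0 := by
  obtain ⟨hN, -⟩ := normal_eq_at_extremum hθ hm hς hu hz hext heq hbdry
  have hκ := contraction_at_extremum hθ hm hς hu hz hext heq hbdry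
  have hρ := Real.exp_pos (u z)
  have hv := slope_pos u z
  have hh : 0 < height (graphPoint c u z) := hH
  have hzC := hemisphere_subset_hemiCone hz
  have hgz := inner_sphGrad_self hu hzC
  have hN' : Real.exp (u z) • z + (m * Real.cos θ) • E₁ n = m • graphNormal u z := by
    rw [hN, graphNormal, smul_smul, div_eq_mul_inv]
  have hn1 : ‖graphNormal u z‖ ^ 2 = 1 := by
    rw [graphNormal, norm_smul, norm_sub_sphGrad hu hz, Real.norm_eq_abs, abs_inv,
      abs_of_pos hv, inv_mul_cancel₀ hv.ne', one_pow]
  have hzN : inner ℝ z (graphNormal u z) = (slope u z)⁻¹ := by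
    rw [graphNormal, inner_smul_right, inner_sub_right, real_inner_comm (sphGrad u z), hgz,
      real_inner_self_eq_norm_sq, hz.1]
    norm_num
  have hlast : Real.exp (u z) * height z = m * height (graphNormal u z) := by
    have := congrArg height hN'
    rwa [height_add, height_smul, height_smul, height_smul, height_E₁, mul_zero, add_zero] at this
  have hheight : height (graphPoint c u z) = c + Real.exp (u z) * height z := by
    rw [graphPoint, height_add, height_smul, height_smul, height_Eₗ, mul_one]
  have hN0 : m * (1 - Real.cos θ * (graphNormal u z) 0) = Real.exp (u z) / slope u z := by
    have := congrArg (fun Y : Amb n => inner ℝ Y (graphNormal u z)) hN'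
    simp only [inner_add_left, inner_smul_left, conj_trivial, inner_E₁_left,
      real_inner_self_eq_norm_sq, hn1, hzN] at this
    rw [div_eq_mul_inv]
    linarith
  have hsub : graphPoint c u z - c • Eₗ n = Real.exp (u z) • z := by
    rw [graphPoint]; abel
  set h := height (graphPoint c u z)
  set N := graphNormal u z
  set v := slope u z
  set ρ := Real.exp (u z)
  have hq : h * graphSpeed c θ u z = n * c * (1 - Real.cos θ * N 0)
      - (h * (n - graphContraction u z) / (ρ * v) - n * height N) * (ρ / v) := by
    simp only [graphSpeed, graphMeanCurvature, hypInner]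
    rw [hsub, inner_smul_right, inner_smul_right, inner_E₁_left, inner_smul_left, hzN]
    simp only [conj_trivial]
    change h * (n * c / h - n * c * Real.cos θ * (h * N 0 / h ^ 2)
      - (h * (n - graphContraction u z) / (ρ * v) - n * height N) * (h * (ρ * v⁻¹) / h ^ 2)) = _
    field_simp
  -- The pairing of the common normal with itself and its last coordinate give `m (1 - cos θ N₀) = ρ
  -- / v` and `c = h - m N_{n+1}`; all terms with `N` then cancel.
  have hq2 : m * (h * graphSpeed c θ u z)
      = (ρ / v) * h * (n - m / v / ρ * (n - graphContraction u z)) := by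
    have hc : c = h - m * height N := by rw [← hlast]; linarith
    have e1 : m * (n * c * (1 - Real.cos θ * N 0)) = n * c * (ρ / v) := by
      rw [← hN0]; ring
    rw [hq, mul_sub, e1, hc]
    field_simp
    ring
  have hq3 : ς * (m * (h * graphSpeed c θ u z)) ≤ 0 := by
    rw [hq2]
    have h1 : 0 ≤ ρ / v * h := by positivity
    nlinarith [mul_nonpos_of_nonpos_of_nonneg hκ h1]
  have hfin : ς * scalarRHS c θ u z = (v / (ρ * m)) * (ς * (m * (h * graphSpeed c θ u z))) := by
    rw [scalarRHS]
    change ς * (v * h / ρ * graphSpeed c θ u z) = _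
    field_simp
  rw [hfin]
  exact mul_nonpos_of_nonneg_of_nonpos (by positivity) hq3

end ScalarExtremum

/-! ### The bound for the scalar equation -/

section ScalarBound

variable {n : ℕ}

theorem isCompact_hemisphere : IsCompact (hemisphere n) := by
  have : hemisphere n = Metric.sphere 0 1 ∩ {z : Amb n | 0 ≤ z 0} := by
    ext z; simp [hemisphere]
  rw [this]
  exact (isCompact_sphere _ _).inter_right (isClosed_le continuous_const continuous_apply_zero)

theorem Icc_subset_timeInterval {T : EReal} {t : ℝ} (ht : t ∈ timeInterval T) :
    Icc 0 t ⊆ timeInterval T := fun _ hs =>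
  ⟨hs.1, (EReal.coe_le_coe_iff.2 hs.2).trans_lt ht.2⟩

/-- `ς (u + log capRadius)` does not exceed its initial maximum. -/
theorem scalar_max_principle [NeZero n] {c θ ς K : ℝ} {T : EReal} {u : ℝ → Amb n → ℝ}
    (hθ : 0 < Real.sin θ) (hς : ς = 1 ∨ ς = -1) (hu : IsScalarSolution c θ T u)
    (h0 : ∀ z ∈ hemisphere n, ς * (u 0 z + Real.log (capRadius θ z)) ≤ K)
    {t : ℝ} (ht : t ∈ timeInterval T) :
    ∀ z ∈ hemisphere n, ς * (u t z + Real.log (capRadius θ z)) ≤ K := by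
  have hsub := Icc_subset_timeInterval ht
  have hςne : ς ≠ 0 := by rcases hς with rfl | rfl <;> norm_num
  have hpos : ∀ z ∈ hemisphere n, 0 < capRadius θ z := fun z hz =>
    capRadius_pos hθ (hemisphere_subset_hemiCone hz).1
  refine le_of_forall_max_not_barrier isCompact_hemisphere
    (φ := fun t z => ς * (u t z + Real.log (capRadius θ z))) ?_ h0 ?_ t ⟨ht.1, le_rfl⟩
  · have h1 : ContinuousOn (Function.uncurry u) (Icc 0 t ×ˢ hemisphere n) :=
      hu.continuous.mono (prod_mono_left hsub)
    have h2 : ContinuousOn (fun p : ℝ × Amb n => Real.log (capRadius θ p.2))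
        (Icc 0 t ×ˢ hemisphere n) :=
      ((continuous_capRadius θ).comp continuous_snd).continuousOn.log
        fun p hp => (hpos _ hp.2).ne'
    exact continuousOn_const.mul (h1.add h2)
  · intro ε hε τ hτ z hz _ hmax hbar
    have hτT : τ ∈ timeInterval T := hsub ⟨hτ.1.le, hτ.2⟩
    -- The radius of the cap through the extremal point of the graph.
    set m := Real.exp (u τ z) * capRadius θ z with hm
    have hm0 : 0 < m := mul_pos (Real.exp_pos _) (hpos z hz)
    have hlog : ∀ y ∈ hemisphere n, u τ y + Real.log (capRadius θ y)
        = Real.log (capRadius θ (Real.exp (u τ y) • y)) := by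
      intro y hy
      rw [capRadius_smul (Real.exp_pos _).le,
        Real.log_mul (Real.exp_pos _).ne' (hpos y hy).ne', Real.log_exp]
    have hmz : capRadius θ (Real.exp (u τ z) • z) = m := capRadius_smul (Real.exp_pos _).le z
    have hypos : ∀ y ∈ hemisphere n, 0 < capRadius θ (Real.exp (u τ y) • y) := fun y hy => by
      rw [capRadius_smul (Real.exp_pos _).le]
      exact mul_pos (Real.exp_pos _) (hpos y hy)
    have hext : ∀ y ∈ hemisphere n,
        ς * (‖Real.exp (u τ y) • y + (m * Real.cos θ) • E₁ n‖ ^ 2 - m ^ 2) ≤ 0 := by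
      intro y hy
      have h := hmax y hy
      simp only [hlog y hy, hlog z hz, hmz] at h
      rcases hς with rfl | rfl
      · rw [one_mul, one_mul, Real.log_le_log_iff (hypos y hy) hm0] at h
        have := pow_le_pow_left₀ (norm_nonneg _) ((capRadius_le_iff hθ hm0 _).1 h) 2
        linarith
      · have h' : Real.log m ≤ Real.log (capRadius θ (Real.exp (u τ y) • y)) := by linarith
        rw [Real.log_le_log_iff hm0 (hypos y hy)] at h'
        have := pow_le_pow_left₀ hm0.le
          (not_lt.1 fun hlt => absurd ((capRadius_lt_iff hθ hm0 _).2 hlt) (not_lt.2 h')) 2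
        linarith
    have heq : ‖Real.exp (u τ z) • z + (m * Real.cos θ) • E₁ n‖ = m := by
      have := norm_add_capRadius hθ (hypos z hz)
      rwa [hmz] at this
    have hR := scalarRHS_at_extremum hθ hm0 hςne (hu.regular τ hτT) hz
      (hu.graph_mem τ hτT z hz) hext heq (hu.boundary τ hτT z hz)
    have hderiv : HasDerivWithinAt (fun s => ς * (u s z + Real.log (capRadius θ z)))
        (ς * scalarRHS c θ (u τ) z) (Iic τ) τ := by
      refine (((hu.evolution τ hτT z hz).mono_of_mem_nhdsWithin ?_).add_const _).const_mul ς
      exact mem_of_superset (Icc_mem_nhdsLE hτ.1) ((Icc_subset_Icc_right hτ.2).trans hsub)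
    have := le_deriv_left_of_barrier hderiv (ε := ε) (by
      filter_upwards [Ioo_mem_nhdsLT hτ.1] with s hs using hbar s ⟨hs.1.le, hs.2.le⟩)
    linarith

/-- The function `log (capRadius θ ·)` is bounded by some `L` on the hemisphere. Passing from `u` to
`u + log (capRadius θ ·)` at time `0` and back at time `t` costs `L` each. -/
theorem scalar_bound [NeZero n] {θ : ℝ} (hθ : 0 < Real.sin θ) (c K : ℝ) :
    ∃ C : ℝ, ∀ (T : EReal) (u : ℝ → Amb n → ℝ),
      0 < T → IsScalarSolution c θ T u → (∀ z ∈ hemisphere n, |u 0 z| ≤ K) →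
      ∀ t ∈ timeInterval T, ∀ z ∈ hemisphere n, |u t z| ≤ C := by
  have hcont : ContinuousOn (fun z : Amb n => Real.log (capRadius θ z)) (hemisphere n) :=
    (continuous_capRadius θ).continuousOn.log fun z hz =>
      (capRadius_pos hθ (hemisphere_subset_hemiCone hz).1).ne'
  obtain ⟨L, hL⟩ := isCompact_hemisphere.exists_bound_of_continuousOn hcont
  refine ⟨K + 2 * L, fun T u _ hu h0 t ht z hz => ?_⟩
  have hLz : ∀ y ∈ hemisphere n, |Real.log (capRadius θ y)| ≤ L := hL
  have h1 := scalar_max_principle hθ (Or.inl rfl) hu (K := K + L) (fun y hy => by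
    linarith [le_abs_self (u 0 y), le_abs_self (Real.log (capRadius θ y)), h0 y hy, hLz y hy])
    ht z hz
  have h2 := scalar_max_principle hθ (Or.inr rfl) hu (K := K + L) (fun y hy => by
    linarith [neg_abs_le (u 0 y), neg_abs_le (Real.log (capRadius θ y)), h0 y hy, hLz y hy])
    ht z hz
  have h3 := abs_le.1 (hLz z hz)
  exact abs_le.2 ⟨by linarith, by linarith⟩

end ScalarBound

/-! ### Segments in a chart of a manifold with boundary -/

section Segments

variable {n : ℕ} [NeZero n] {M : Type*} [TopologicalSpace M]
  [ChartedSpace (EuclideanHalfSpace n) M]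

/-- The curve through `p` that is a segment in direction `v` in the preferred chart. -/
noncomputable def chartSegment (p : M) (v : EuclideanSpace ℝ (Fin n)) (s : ℝ) : M :=
  (extChartAt (𝓡∂ n) p).symm (extChartAt (𝓡∂ n) p p + s • v)

/-- The direction `v` points into the image of the charts at `p`. -/
def IsInward (p : M) (v : EuclideanSpace ℝ (Fin n)) : Prop :=
  p ∈ (𝓡∂ n).interior M ∨ 0 ≤ v 0

theorem chartSegment_zero (p : M) (v : EuclideanSpace ℝ (Fin n)) : chartSegment p v 0 = p := by
  rw [chartSegment, zero_smul, add_zero]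
  exact extChartAt_to_inv p

theorem exists_segment_mem_target {p : M} {v : EuclideanSpace ℝ (Fin n)} (hv : IsInward p v) :
    ∃ ε > 0, ∀ s ∈ Ico (0 : ℝ) ε,
      extChartAt (𝓡∂ n) p p + s • v ∈ (extChartAt (𝓡∂ n) p).target := by
  have hc : Continuous fun s : ℝ => extChartAt (𝓡∂ n) p p + s • v := by fun_prop
  have hr : ∀ᶠ s in 𝓝[≥] (0 : ℝ), extChartAt (𝓡∂ n) p p + s • v ∈ range (𝓡∂ n) := by
    rcases hv with h | h
    · have h1 : interior (range (𝓡∂ n)) ∈ 𝓝 (extChartAt (𝓡∂ n) p p + (0 : ℝ) • v) := by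
        rw [zero_smul, add_zero]
        exact isOpen_interior.mem_nhds h
      filter_upwards [nhdsWithin_le_nhds (hc.continuousAt.eventually_mem h1)] with s hs
      exact interior_subset hs
    · filter_upwards [self_mem_nhdsWithin] with s hs
      have hs : 0 ≤ s := hs
      have h0 : extChartAt (𝓡∂ n) p p ∈ range (𝓡∂ n) := by
        rw [extChartAt_coe]; exact mem_range_self _
      rw [range_modelWithCornersEuclideanHalfSpace] at h0 ⊢
      have h0 : 0 ≤ (extChartAt (𝓡∂ n) p p) 0 := h0
      change 0 ≤ (extChartAt (𝓡∂ n) p p + s • v) 0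
      simp only [PiLp.add_apply, PiLp.smul_apply, smul_eq_mul]
      positivity
  have ht : Tendsto (fun s : ℝ => extChartAt (𝓡∂ n) p p + s • v) (𝓝[≥] 0)
      (𝓝[range (𝓡∂ n)] (extChartAt (𝓡∂ n) p p)) := by
    refine tendsto_nhdsWithin_iff.2 ⟨?_, hr⟩
    have := hc.tendsto 0
    rw [zero_smul, add_zero] at this
    exact this.mono_left nhdsWithin_le_nhds
  obtain ⟨ε, hε, h⟩ := mem_nhdsGE_iff_exists_Ico_subset.1
    (ht.eventually_mem (extChartAt_target_mem_nhdsWithin p))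
  exact ⟨ε, hε, h⟩

variable {E : Type*} [NormedAddCommGroup E] [NormedSpace ℝ E]

theorem hasDerivWithinAt_chartSegment_zero {f : M → E} {p : M}
    (hf : MDifferentiableAt (𝓡∂ n) 𝓘(ℝ, E) f p) {v : EuclideanSpace ℝ (Fin n)} {ε : ℝ}
    (hmem : ∀ s ∈ Ico (0 : ℝ) ε,
      extChartAt (𝓡∂ n) p p + s • v ∈ (extChartAt (𝓡∂ n) p).target) :
    HasDerivWithinAt (fun s => f (chartSegment p v s)) (mfderiv (𝓡∂ n) 𝓘(ℝ, E) f p v)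
      (Ico 0 ε) 0 := by
  have hd := hf.hasMFDerivAt.2
  have hl : HasDerivWithinAt (fun s : ℝ => extChartAt (𝓡∂ n) p p + s • v) v (Ico 0 ε) 0 := by
    simpa using (((hasDerivAt_id (0 : ℝ)).smul_const v).const_add
      (extChartAt (𝓡∂ n) p p)).hasDerivWithinAt
  exact HasFDerivWithinAt.comp_hasDerivWithinAt_of_eq (0 : ℝ) hd hl
    (fun s hs => extChartAt_target_subset_range p (hmem s hs)) (by simp)

/-- Along a chart segment a `C¹` map has a velocity that is continuous at `0` and lies in the
range of the differential. -/
theorem exists_velocity_chartSegment [IsManifold (𝓡∂ n) ∞ M] {f : M → E}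
    (hf : ContMDiff (𝓡∂ n) 𝓘(ℝ, E) 1 f) {p : M}
    {v : EuclideanSpace ℝ (Fin n)} {ε : ℝ} (hε : 0 < ε)
    (hmem : ∀ s ∈ Ico (0 : ℝ) ε,
      extChartAt (𝓡∂ n) p p + s • v ∈ (extChartAt (𝓡∂ n) p).target) :
    ∃ D : ℝ → E, D 0 = mfderiv (𝓡∂ n) 𝓘(ℝ, E) f p v ∧
      Tendsto D (𝓝[>] 0) (𝓝 (D 0)) ∧
      ∀ s ∈ Ico 0 ε, HasDerivWithinAt (fun s => f (chartSegment p v s)) (D s) (Ico 0 ε) s ∧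
        ∃ w, D s = mfderiv (𝓡∂ n) 𝓘(ℝ, E) f (chartSegment p v s) w := by
  set e := extChartAt (𝓡∂ n) p with he
  have : IsManifold (𝓡∂ n) 1 M := IsManifold.of_le (n := ∞) (by simp)
  have hsymm : ContMDiffOn 𝓘(ℝ, EuclideanSpace ℝ (Fin n)) (𝓡∂ n) 1 e.symm e.target :=
    contMDiffOn_extChartAt_symm p
  have hg : ContDiffOn ℝ 1 (f ∘ e.symm) e.target :=
    (hf.comp_contMDiffOn hsymm).contDiffOn
  have huniq : UniqueDiffOn ℝ e.target := uniqueDiffOn_extChartAt_target p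
  have hl : ∀ s, HasDerivWithinAt (fun s : ℝ => e p + s • v) v (Ico 0 ε) s := fun s => by
    simpa using (((hasDerivAt_id s).smul_const v).const_add (e p)).hasDerivWithinAt
  have hderiv : ∀ s ∈ Ico 0 ε, HasDerivWithinAt (fun s => f (chartSegment p v s))
      (fderivWithin ℝ (f ∘ e.symm) e.target (e p + s • v) v) (Ico 0 ε) s := fun s hs =>
    HasFDerivWithinAt.comp_hasDerivWithinAt (l := f ∘ e.symm) s
      (hg.differentiableOn (by norm_num) _ (hmem s hs)).hasFDerivWithinAt (hl s) hmem
  refine ⟨fun s => fderivWithin ℝ (f ∘ e.symm) e.target (e p + s • v) v, ?_, ?_,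
    fun s hs => ⟨hderiv s hs, ?_⟩⟩
  · have h0 : (0 : ℝ) ∈ Ico 0 ε := ⟨le_rfl, hε⟩
    have hu : UniqueDiffWithinAt ℝ (Ico (0 : ℝ) ε) 0 := uniqueDiffOn_Ico 0 ε 0 h0
    exact hu.eq_deriv _ (hderiv 0 h0) (hasDerivWithinAt_chartSegment_zero
      (hf.mdifferentiable (by norm_num) p) hmem)
  · have hc : ContinuousOn (fderivWithin ℝ (f ∘ e.symm) e.target) e.target :=
      hg.continuousOn_fderivWithin huniq (by norm_num)
    have h0 : (0 : ℝ) ∈ Ico 0 ε := ⟨le_rfl, hε⟩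
    have hcomp : ContinuousOn
        (fun s : ℝ => fderivWithin ℝ (f ∘ e.symm) e.target (e p + s • v) v) (Ico 0 ε) :=
      (hc.comp (by fun_prop : Continuous fun s : ℝ => e p + s • v).continuousOn hmem).clm_apply
        continuousOn_const
    exact (hcomp 0 h0).tendsto.mono_left (nhdsWithin_le_of_mem
      (mem_of_superset (Ioo_mem_nhdsGT hε) Ioo_subset_Ico_self))
  · have hsd : MDifferentiableWithinAt 𝓘(ℝ, EuclideanSpace ℝ (Fin n)) (𝓡∂ n) e.symm e.target
        (e p + s • v) := hsymm.mdifferentiableOn (by norm_num) _ (hmem s hs)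
    have hfd : MDifferentiableAt (𝓡∂ n) 𝓘(ℝ, E) f (e.symm (e p + s • v)) :=
      hf.mdifferentiable (by norm_num) _
    have hcomp := mfderiv_comp_mfderivWithin (e p + s • v) hfd hsd
      (uniqueMDiffWithinAt_iff_uniqueDiffWithinAt.2 (huniq _ (hmem s hs)))
    refine ⟨mfderivWithin 𝓘(ℝ, EuclideanSpace ℝ (Fin n)) (𝓡∂ n) e.symm e.target
      (e p + s • v) v, ?_⟩
    rw [mfderivWithin_eq_fderivWithin] at hcomp
    exact congrArg (fun L : EuclideanSpace ℝ (Fin n) →L[ℝ] E => L v) hcomp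

end Segments

/-! ### First and second order conditions on a hypersurface -/

section Extremum

variable {n : ℕ} [NeZero n] {M : Type*} [TopologicalSpace M]
  [ChartedSpace (EuclideanHalfSpace n) M]
  {x ν : M → Amb n} {o : Amb n} {p : M} {ς : ℝ}

theorem inner_diff_nonpos_of_isInward (hx : ContMDiff (𝓡∂ n) 𝓘(ℝ, Amb n) 1 x)
    (hext : ∀ q, ς * ‖x q - o‖ ^ 2 ≤ ς * ‖x p - o‖ ^ 2) {v : EuclideanSpace ℝ (Fin n)}
    (hv : IsInward p v) : ς * inner ℝ (x p - o) (diff x p v) ≤ 0 := by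
  obtain ⟨ε, hε, hmem⟩ := exists_segment_mem_target hv
  have hd := hasDerivWithinAt_chartSegment_zero (hx.mdifferentiable (by norm_num) p) hmem
  have h1 := ((hd.sub_const o).norm_sq.const_mul ς).mono_of_mem_nhdsWithin (Ico_mem_nhdsGE hε)
  have h2 := deriv_right_nonpos_of_le h1 (Eventually.of_forall fun s => by
    rw [chartSegment_zero]; exact hext _)
  rw [chartSegment_zero] at h2
  change ς * (2 * inner ℝ (x p - o) (diff x p v)) ≤ 0 at h2
  linarith

theorem inner_diff_eq_zero (hx : ContMDiff (𝓡∂ n) 𝓘(ℝ, Amb n) 1 x) (hς : ς ≠ 0)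
    (hext : ∀ q, ς * ‖x q - o‖ ^ 2 ≤ ς * ‖x p - o‖ ^ 2) {v : EuclideanSpace ℝ (Fin n)}
    (hv : p ∈ (𝓡∂ n).interior M ∨ v 0 = 0) : inner ℝ (x p - o) (diff x p v) = 0 := by
  have h1 := inner_diff_nonpos_of_isInward hx hext (v := v) (hv.imp_right fun h => h.ge)
  have h2 := inner_diff_nonpos_of_isInward hx hext (v := -v)
    (hv.imp_right fun h => by simp [h])
  have h3 : diff x p (-v) = -diff x p v := map_neg _ _
  rw [h3, inner_neg_right] at h2
  exact (mul_eq_zero.1 (show ς * inner ℝ (x p - o) (diff x p v) = 0 by linarith)).resolve_left hς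

/-- The first coordinate has a minimum at `p`, and both `v` and `-v` are inward directions. -/
theorem diff_apply_zero_eq_zero (hx : ContMDiff (𝓡∂ n) 𝓘(ℝ, Amb n) 1 x) (hp : x p 0 = 0)
    (hnn : ∀ q, 0 ≤ x q 0) {v : EuclideanSpace ℝ (Fin n)} (hv : v 0 = 0) :
    (diff x p v) 0 = 0 := by
  have key : ∀ w : EuclideanSpace ℝ (Fin n), 0 ≤ w 0 → 0 ≤ (diff x p w) 0 := by
    intro w hw
    obtain ⟨ε, hε, hmem⟩ := exists_segment_mem_target (p := p) (v := w) (Or.inr hw)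
    have hd := hasDerivWithinAt_chartSegment_zero (hx.mdifferentiable (by norm_num) p) hmem
    have h1 := (HasFDerivWithinAt.comp_hasDerivWithinAt (0 : ℝ)
      (-(EuclideanSpace.proj (𝕜 := ℝ) (0 : Fin (n + 1)) :
        Amb n →L[ℝ] ℝ)).hasFDerivAt.hasFDerivWithinAt hd (mapsTo_univ _ _)).mono_of_mem_nhdsWithin
      (Ico_mem_nhdsGE hε)
    have h2 := deriv_right_nonpos_of_le h1 (Eventually.of_forall fun s => by
      simp only [Function.comp_apply, chartSegment_zero]
      simpa [hp] using hnn (chartSegment p w s))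
    have h3 : -((diff x p w) 0) ≤ 0 := h2
    linarith
  have h1 := key v hv.ge
  have h2 := key (-v) (by simp [hv])
  have h3 : diff x p (-v) = -diff x p v := map_neg _ _
  rw [h3, PiLp.neg_apply] at h2
  linarith

/-- The second order condition at an extremum of the distance to `o`, in terms of the derivative
of a normal field. -/
theorem second_order_condition [IsManifold (𝓡∂ n) ∞ M]
    (hx : ContMDiff (𝓡∂ n) 𝓘(ℝ, Amb n) 1 x) (hν : ContMDiff (𝓡∂ n) 𝓘(ℝ, Amb n) 1 ν)
    (horth : ∀ q (w : TangentSpace (𝓡∂ n) q), inner ℝ (diff x q w) (ν q) = 0)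
    (hext : ∀ q, ς * ‖x q - o‖ ^ 2 ≤ ς * ‖x p - o‖ ^ 2) {l : ℝ} (hl : x p - o = l • ν p)
    (v : EuclideanSpace ℝ (Fin n)) :
    ς * (inner ℝ (diff x p v) (diff x p v) - l * inner ℝ (diff ν p v) (diff x p v)) ≤ 0 := by
  have key : ∀ w : EuclideanSpace ℝ (Fin n), IsInward p w →
      ς * (inner ℝ (diff x p w) (diff x p w) - l * inner ℝ (diff ν p w) (diff x p w)) ≤ 0 := by
    intro w hw
    obtain ⟨ε, hε, hmem⟩ := exists_segment_mem_target hw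
    obtain ⟨D, hD0, hDc, hD⟩ := exists_velocity_chartSegment hx hε hmem
    have hνd := hasDerivWithinAt_chartSegment_zero (hν.mdifferentiable (by norm_num) p) hmem
    have hxd := hasDerivWithinAt_chartSegment_zero (hx.mdifferentiable (by norm_num) p) hmem
    -- Since velocities are orthogonal to `ν`, the derivative of the squared distance is `2 ⟨Y, D⟩`,
    -- and `Y` vanishes at `0`. Divided by `s` it tends to `2 ⟨Y'(0), D(0)⟩`, so no second
    -- derivative of `x` enters.
    set Y : ℝ → Amb n :=
      fun s => x (chartSegment p w s) - o - l • ν (chartSegment p w s) with hY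
    have hY0 : Y 0 = 0 := by simp [hY, chartSegment_zero, hl]
    have hYd : HasDerivWithinAt Y (diff x p w - l • diff ν p w) (Ico 0 ε) 0 :=
      (hxd.sub_const o).sub (hνd.const_smul l)
    have hYlim : Tendsto (fun s : ℝ => s⁻¹ • Y s) (𝓝[>] 0) (𝓝 (diff x p w - l • diff ν p w)) := by
      have h1 := (hasDerivWithinAt_iff_tendsto_slope' (by simp)).1
        ((hYd.mono_of_mem_nhdsWithin (Ico_mem_nhdsGE hε)).mono Ioi_subset_Ici_self)
      refine h1.congr fun s => ?_
      rw [_root_.slope, hY0, vsub_eq_sub, sub_zero, sub_zero]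
    have hlim := (hYlim.inner hDc).const_mul (ς * 2)
    rw [hD0] at hlim
    have h2 := nonpos_of_tendsto_deriv_div (k := fun s => ς * ‖x (chartSegment p w s) - o‖ ^ 2)
      (k' := fun s => ς * (2 * inner ℝ (x (chartSegment p w s) - o) (D s))) hε
      (fun s hs => ((hD s hs).1.sub_const o).norm_sq.const_mul ς)
      (fun s _ => by rw [chartSegment_zero]; exact hext _)
      (hlim.congr' ?_)
    · have h3 : ς * 2 * inner ℝ (diff x p w - l • diff ν p w) (diff x p w) ≤ 0 := h2
      rw [inner_sub_left, inner_smul_left, conj_trivial] at h3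
      linarith
    · filter_upwards [Ioo_mem_nhdsGT hε] with s hs
      obtain ⟨y, hy⟩ := (hD s ⟨hs.1.le, hs.2⟩).2
      have h3 : inner ℝ (ν (chartSegment p w s)) (D s) = 0 := by
        rw [real_inner_comm, hy]
        exact horth _ y
      rw [inner_smul_left, conj_trivial, hY]
      simp only
      rw [inner_sub_left, inner_smul_left, h3]
      simp only [conj_trivial]
      field_simp
      ring
  rcases le_total 0 (v 0) with h | h
  · exact key v (Or.inr h)
  · have h1 := key (-v) (Or.inr (by simpa using h))
    have h2 : diff x p (-v) = -diff x p v := map_neg _ _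
    have h3 : diff ν p (-v) = -diff ν p v := map_neg _ _
    rw [h2, h3, inner_neg_neg, inner_neg_neg] at h1
    exact h1

end Extremum

/-! ### The speed of a capillary hypersurface at an extremal cap -/

section CapillaryExtremum

variable {n : ℕ}

/-- The Euclidean centre of the cap of radius `m`. -/
noncomputable def capCenter (n : ℕ) (c θ m : ℝ) : Amb n :=
  c • Eₗ n - (m * Real.cos θ) • E₁ n

theorem sub_capCenter (c θ m : ℝ) (y : Amb n) :
    y - capCenter n c θ m = y - c • Eₗ n + (m * Real.cos θ) • E₁ n := by
  rw [capCenter]; abel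

theorem height_capCenter [NeZero n] (c θ m : ℝ) : height (capCenter n c θ m) = c := by
  rw [capCenter, height_sub, height_smul, height_smul, height_Eₗ, height_E₁]
  ring

theorem dotProduct_mulVec_inner (A B : EuclideanSpace ℝ (Fin n) →L[ℝ] Amb n) (v : Fin n → ℝ) :
    v ⬝ᵥ (Matrix.of fun i j => (inner ℝ (A (EuclideanSpace.single i 1))
      (B (EuclideanSpace.single j 1)) : ℝ)).mulVec v
      = inner ℝ (A (WithLp.toLp 2 v)) (B (WithLp.toLp 2 v)) := by
  have h : ∀ L : EuclideanSpace ℝ (Fin n) →L[ℝ] Amb n,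
      L (WithLp.toLp 2 v) = ∑ i, v i • L (EuclideanSpace.single i 1) := by
    intro L
    conv_lhs => rw [← sum_single_eq (WithLp.toLp 2 v), map_sum]
    simp
  rw [h A, h B, sum_inner]
  simp only [inner_sum, inner_smul_left, inner_smul_right, conj_trivial, dotProduct,
    Matrix.mulVec, Matrix.of_apply, Finset.mul_sum]
  refine Finset.sum_congr rfl fun i _ => Finset.sum_congr rfl fun j _ => ?_
  ring

variable [NeZero n] {M : Type*} [TopologicalSpace M] [ChartedSpace (EuclideanHalfSpace n) M]
  {x ν : M → Amb n} {c θ m ς : ℝ} {p : M}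

theorem IsCapillary.height_pos (hx : IsCapillary θ x ν) (p : M) : 0 < height (x p) := by
  have hp : p ∈ (𝓡∂ n).interior M ∪ (𝓡∂ n).boundary M := by
    rw [ModelWithCorners.interior_union_boundary_eq_univ]; trivial
  rcases hp with h | h
  · exact (hx.interior_subset p h).1
  · exact (hx.boundary_subset p h).1

theorem IsCapillary.apply_zero_nonneg (hx : IsCapillary θ x ν) (p : M) : 0 ≤ x p 0 := by
  have hp : p ∈ (𝓡∂ n).interior M ∪ (𝓡∂ n).boundary M := by
    rw [ModelWithCorners.interior_union_boundary_eq_univ]; trivial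
  rcases hp with h | h
  · exact (hx.interior_subset p h).2.le
  · exact (hx.boundary_subset p h).2.ge

theorem IsCapillary.inner_diff_normal (hx : IsCapillary θ x ν) (p : M)
    (v : TangentSpace (𝓡∂ n) p) : inner ℝ (diff x p v) (ν p) = 0 := by
  have h := hx.normal.orthogonal p v
  have hh := hx.height_pos p
  rw [hypInner, div_eq_zero_iff] at h
  exact h.resolve_right (by positivity)

theorem IsCapillary.norm_normal (hx : IsCapillary θ x ν) (p : M) : ‖ν p‖ = height (x p) := by
  have h := hx.normal.unit p
  have hh := hx.height_pos p
  rw [hypInner, real_inner_self_eq_norm_sq, div_eq_one_iff_eq (by positivity)] at h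
  exact (sq_eq_sq₀ (norm_nonneg _) hh.le).1 h

/-- The differential in the coordinates of the preferred chart. -/
noncomputable def coordDiff (f : M → Amb n) (p : M) : EuclideanSpace ℝ (Fin n) →L[ℝ] Amb n :=
  diff f p

/-- Conformal change of the second fundamental form: against a tangent vector, only the term
`-(ν_{n+1} / x_{n+1}) ∂_i` of the Christoffel tensor survives. -/
theorem secondForm_apply (hx : IsCapillary θ x ν) (p : M) (i j : Fin n) :
    secondForm x ν p i j = inner ℝ (diff ν p (coordVec p i)) (diff x p (coordVec p j))
        / height (x p) ^ 2 - height (ν p) / height (x p) * firstForm x p i j := by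
  have h1 := hx.inner_diff_normal p (coordVec p i)
  have h2 := hx.inner_diff_normal p (coordVec p j)
  rw [real_inner_comm] at h2
  have hh := hx.height_pos p
  simp only [secondForm, firstForm, Matrix.of_apply, hypInner, covDeriv, hypChristoffel]
  rw [inner_add_left, inner_neg_left, inner_smul_left, inner_sub_left, inner_add_left,
    inner_smul_left, inner_smul_left, inner_smul_left, h1, h2]
  simp only [conj_trivial]
  field_simp
  ring

theorem posDef_firstForm (hx : IsCapillary θ x ν) (p : M) : (firstForm x p).PosDef := by
  have hh := hx.height_pos p
  have hF : firstForm x p = (height (x p) ^ 2)⁻¹ • (Matrix.of fun i j =>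
      (inner ℝ (coordDiff x p (EuclideanSpace.single i (1 : ℝ)))
        (coordDiff x p (EuclideanSpace.single j (1 : ℝ))) : ℝ)) := by
    ext i j
    simp only [firstForm, hypInner, coordVec, Matrix.smul_apply, Matrix.of_apply, smul_eq_mul]
    rw [div_eq_inv_mul]
    rfl
  refine Matrix.posDef_iff_dotProduct_mulVec.2 ⟨?_, fun v hv => ?_⟩
  · ext i j
    simp [firstForm, hypInner, real_inner_comm]
  · rw [hF, star_trivial, Matrix.smul_mulVec, dotProduct_smul,
      dotProduct_mulVec_inner (coordDiff x p) (coordDiff x p), smul_eq_mul, real_inner_self_eq_norm_sq]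
    have : coordDiff x p (WithLp.toLp 2 v) ≠ 0 := by
      intro h0
      have h1 := hx.immersion p (h0.trans (map_zero (diff x p)).symm)
      have h2 : (WithLp.toLp 2 v : EuclideanSpace ℝ (Fin n)) = 0 := h1
      exact hv (by simpa using congrArg (WithLp.ofLp (p := 2)) h2)
    have := norm_pos_iff.2 this
    positivity

/-- The contact sphere has second fundamental form `(c / m) g`. The second order condition says that
`ς (h - (c / m) g)` is nonnegative as a quadratic form; tracing with `g⁻¹` gives the claim. -/
theorem meanCurvature_at_extremum [IsManifold (𝓡∂ n) ∞ M] (hx : IsCapillary θ x ν) (hm : 0 < m)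
    (hext : ∀ q, ς * ‖x q - capCenter n c θ m‖ ^ 2 ≤ ς * ‖x p - capCenter n c θ m‖ ^ 2)
    (hN : x p - capCenter n c θ m = (m / height (x p)) • ν p) :
    0 ≤ ς * (meanCurvature x ν p - n * c / m) := by
  have hh := hx.height_pos p
  have hF := posDef_firstForm hx p
  have h2nd := second_order_condition (hx.regular.of_le (by norm_num)) hx.normal.regular
    hx.inner_diff_normal hext hN
  -- The last coordinate of `hN`; it converts the Euclidean curvature `1 / m` of the sphere into the
  -- hyperbolic one, `c / m`.
  have hlast : height (ν p) / height (x p) + c / m = height (x p) / m := by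
    have h := congrArg height hN
    rw [height_sub, height_smul, height_capCenter] at h
    field_simp at h ⊢
    linarith
  set Q : Matrix (Fin n) (Fin n) ℝ := ς • (secondForm x ν p - (c / m) • firstForm x p) with hQ
  have hQ' : Q = (ς * (height (x p) ^ 2)⁻¹) • ((Matrix.of fun i j =>
      (inner ℝ (coordDiff ν p (EuclideanSpace.single i (1 : ℝ)))
        (coordDiff x p (EuclideanSpace.single j (1 : ℝ))) : ℝ)) - (height (x p) / m) •
      (Matrix.of fun i j => (inner ℝ (coordDiff x p (EuclideanSpace.single i (1 : ℝ)))
        (coordDiff x p (EuclideanSpace.single j (1 : ℝ))) : ℝ))) := by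
    ext i j
    rw [hQ, ← hlast]
    simp only [Matrix.smul_apply, Matrix.sub_apply, secondForm_apply hx, smul_eq_mul,
      Matrix.of_apply]
    simp only [firstForm, hypInner, coordVec, Matrix.of_apply]
    change ς * (inner ℝ (coordDiff ν p (EuclideanSpace.single i (1 : ℝ)))
      (coordDiff x p (EuclideanSpace.single j (1 : ℝ))) / height (x p) ^ 2
      - height (ν p) / height (x p) * (inner ℝ (coordDiff x p (EuclideanSpace.single i (1 : ℝ)))
        (coordDiff x p (EuclideanSpace.single j (1 : ℝ))) / height (x p) ^ 2)
      - c / m * (inner ℝ (coordDiff x p (EuclideanSpace.single i (1 : ℝ)))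
        (coordDiff x p (EuclideanSpace.single j (1 : ℝ))) / height (x p) ^ 2)) = _
    ring
  have hQnn : ∀ v : Fin n → ℝ, 0 ≤ v ⬝ᵥ Q.mulVec v := by
    intro v
    rw [hQ', Matrix.smul_mulVec, dotProduct_smul, Matrix.sub_mulVec, dotProduct_sub,
      Matrix.smul_mulVec, dotProduct_smul, dotProduct_mulVec_inner (coordDiff ν p) (coordDiff x p),
      dotProduct_mulVec_inner (coordDiff x p) (coordDiff x p), smul_eq_mul, smul_eq_mul]
    have h : ς * (inner ℝ (coordDiff x p (WithLp.toLp 2 v)) (coordDiff x p (WithLp.toLp 2 v))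
      - m / height (x p) * inner ℝ (coordDiff ν p (WithLp.toLp 2 v))
        (coordDiff x p (WithLp.toLp 2 v))) ≤ 0 := h2nd (WithLp.toLp 2 v)
    have h3 := mul_nonneg (neg_nonneg.2 h)
      (by positivity : 0 ≤ (height (x p) ^ 2)⁻¹ * (height (x p) / m))
    refine h3.trans (le_of_eq ?_)
    field_simp
    ring
  have htr := trace_inv_mul_nonneg hF hQnn
  have hdet : IsUnit (firstForm x p).det := (Matrix.isUnit_iff_isUnit_det _).1 hF.isUnit
  rw [hQ, Matrix.mul_smul, Matrix.trace_smul, Matrix.mul_sub, Matrix.mul_smul,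
    Matrix.nonsing_inv_mul _ hdet, Matrix.trace_sub, Matrix.trace_smul, Matrix.trace_one,
    Fintype.card_fin, smul_eq_mul, smul_eq_mul] at htr
  rw [meanCurvature]
  refine htr.trans (le_of_eq ?_)
  ring

theorem abs_cos_lt_one (hθ : 0 < Real.sin θ) : |Real.cos θ| < 1 := by
  rw [← sq_lt_one_iff_abs_lt_one]
  nlinarith [Real.sin_sq_add_cos_sq θ]

theorem cos_mul_lt (hθ : 0 < Real.sin θ) {a b : ℝ} (hb : 0 < b) (ha : |a| ≤ b) :
    Real.cos θ * a < b := by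
  have h1 := abs_cos_lt_one hθ
  have h2 : |Real.cos θ * a| < b := by
    rw [abs_mul]
    nlinarith [abs_nonneg (Real.cos θ), abs_nonneg a]
  exact (le_abs_self _).trans_lt h2

theorem inner_normal_of_eq (hθ : 0 < Real.sin θ) (hx : IsCapillary θ x ν) (hm : 0 < m)
    (hN : x p - capCenter n c θ m = (m / height (x p)) • ν p) :
    inner ℝ (x p - c • Eₗ n) (ν p) = m * (height (x p) - Real.cos θ * ν p 0) ∧
      0 < height (x p) - Real.cos θ * ν p 0 := by
  have hh := hx.height_pos p
  have hn := hx.norm_normal p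
  constructor
  · have h1 : x p - c • Eₗ n = (m / height (x p)) • ν p - (m * Real.cos θ) • E₁ n := by
      rw [← hN, sub_capCenter]; abel
    rw [h1, inner_sub_left, inner_smul_left, inner_smul_left, real_inner_self_eq_norm_sq, hn,
      inner_E₁_left]
    simp only [conj_trivial]
    field_simp
  · have := cos_mul_lt hθ hh ((abs_apply_zero_le (ν p)).trans hn.le)
    linarith

/-- Inserting the support function of the cap, the first two terms of `q_c` combine to `n c / m`
times that function. Hence `q_c` is `-(H - n c / m)` times a factor that is positive because `|cos
θ| < 1`. -/
theorem normalSpeed_at_extremum [IsManifold (𝓡∂ n) ∞ M] (hθ : 0 < Real.sin θ)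
    (hx : IsCapillary θ x ν) (hm : 0 < m)
    (hext : ∀ q, ς * ‖x q - capCenter n c θ m‖ ^ 2 ≤ ς * ‖x p - capCenter n c θ m‖ ^ 2)
    (hN : x p - capCenter n c θ m = (m / height (x p)) • ν p) :
    ς * normalSpeed c θ x ν p ≤ 0 := by
  have hh := hx.height_pos p
  have hH := meanCurvature_at_extremum hx hm hext hN
  obtain ⟨h1, h2⟩ := inner_normal_of_eq hθ hx hm hN
  have h3 : ς * normalSpeed c θ x ν p = -(ς * (meanCurvature x ν p - n * c / m)
      * (m * (height (x p) - Real.cos θ * ν p 0) / height (x p) ^ 2)) := by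
    rw [normalSpeed, hypInner, hypInner, h1, inner_E₁_left]
    field_simp
    ring
  rw [h3, neg_nonpos]
  positivity

end CapillaryExtremum

/-! ### The position of the enclosed domain relative to the extremal caps -/

section EnclosedDomain

variable {n : ℕ}

theorem convex_PPlus : Convex ℝ (PPlus n) := by
  intro x hx y hy a b ha hb hab
  have h1 : 0 < height x := hx.1
  have h2 : 0 < height y := hy.1
  have key : ∀ r t : ℝ, 0 < r → 0 < t → 0 < a * r + b * t := by
    intro r t hr ht
    rcases ha.eq_or_lt with h | h
    · have : b = 1 := by linarith
      rw [← h, this]; linarith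
    · have := mul_pos h hr
      have := mul_nonneg hb ht.le
      linarith
  exact ⟨key _ _ h1 h2, key _ _ hx.2 hy.2⟩

variable {M : Type*} {x : M → Amb n} {Ω : Set (Amb n)} {o : Amb n} {m : ℝ}

theorem subset_of_mem_of_disjoint_range (hΩ : IsEnclosedDomain x Ω) {S : Set (Amb n)}
    (hS : IsPreconnected S) (hSP : S ⊆ PPlus n) (hSx : Disjoint S (range x)) {y : Amb n}
    (hyS : y ∈ S) (hy : y ∈ Ω) : S ⊆ Ω := by
  have hd : Disjoint S (frontier Ω) := by
    rw [Set.disjoint_left]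
    intro z hz hzf
    have h1 : z ∈ range x ∩ PPlus n := by
      rw [← hΩ.frontier_eq]; exact ⟨hzf, hSP hz⟩
    exact Set.disjoint_left.1 hSx hz h1.1
  rcases subset_or_disjoint_of_disjoint_frontier hS hΩ.isOpen hd with h | h
  · exact h
  · exact absurd hy (Set.disjoint_left.1 h hyS)

theorem norm_add_smul_Eₗ_sub (y o : Amb n) (s : ℝ) :
    ‖y + s • Eₗ n - o‖ ^ 2 = ‖y - o‖ ^ 2 + 2 * s * (height y - height o) + s ^ 2 := by
  have h1 : ‖Eₗ n‖ = 1 := by simp [Eₗ]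
  rw [show y + s • Eₗ n - o = (y - o) + s • Eₗ n by abel, norm_add_sq_real, inner_smul_right,
    inner_Eₗ, norm_smul, h1, mul_one, Real.norm_eq_abs, sq_abs, height_sub]
  ring

/-- The enclosed domain lies in every ball, centred in `ℝ^{n+1}`, that contains the
hypersurface. -/
theorem norm_sub_le_of_mem_enclosed [NeZero n] (hΩ : IsEnclosedDomain x Ω) (hm : 0 ≤ m)
    (hext : ∀ q, ‖x q - o‖ ≤ m) {y : Amb n} (hy : y ∈ Ω) : ‖y - o‖ ≤ m := by
  by_contra! hlt
  obtain ⟨K, hK, hKH, hΩK⟩ := hΩ.bounded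
  have hyP := hΩ.subset hy
  have hyh : 0 < height y := hyP.1
  -- From a point of the domain outside the ball, move vertically away from the height of `o`. This
  -- stays in `P₊` and does not approach `o`, hence never meets the hypersurface and stays in the
  -- domain. Upwards it is unbounded and downwards it tends to height `0`; both contradict
  -- compactness of `K` in hyperbolic space.
  have key : ∀ J : Set ℝ, IsPreconnected J → (0 : ℝ) ∈ J →
      (∀ s ∈ J, 0 < height y + s ∧ 0 ≤ s * (height y - height o)) →
      ∀ s ∈ J, y + s • Eₗ n ∈ K := by
    intro J hJ h0 hJs s hs
    have hc : Continuous fun s : ℝ => y + s • Eₗ n := by fun_prop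
    refine hΩK (subset_of_mem_of_disjoint_range hΩ (hJ.image _ hc.continuousOn) ?_ ?_
      ⟨0, h0, by simp⟩ hy ⟨s, hs, rfl⟩)
    · rintro _ ⟨r, hr, rfl⟩
      refine ⟨?_, ?_⟩
      · change 0 < height (y + r • Eₗ n)
        rw [height_add, height_smul, height_Eₗ, mul_one]
        exact (hJs r hr).1
      · simpa [Eₗ_zero] using hyP.2
    · rw [Set.disjoint_left]
      rintro _ ⟨r, hr, rfl⟩ ⟨q, hq⟩
      have h1 := hext q
      rw [hq] at h1
      have h2 := norm_add_smul_Eₗ_sub y o r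
      have h3 := pow_le_pow_left₀ (norm_nonneg _) h1 2
      have h4 : m ^ 2 < ‖y - o‖ ^ 2 := pow_lt_pow_left₀ hlt hm (by norm_num)
      nlinarith [(hJs r hr).2, sq_nonneg r]
  have hheight : ∀ s : ℝ, height (y + s • Eₗ n) = height y + s := fun s => by
    rw [height_add, height_smul, height_Eₗ, mul_one]
  rcases le_total (height o) (height y) with h | h
  · have h1 := key (Ici 0) isPreconnected_Ici self_mem_Ici fun s hs =>
      ⟨add_pos_of_pos_of_nonneg hyh hs, mul_nonneg hs (by linarith)⟩
    obtain ⟨B, hB⟩ := (hK.image continuous_height).bddAbove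
    have h2 := hB ⟨_, h1 (max 0 (B - height y + 1)) (mem_Ici.2 (le_max_left _ _)), rfl⟩
    rw [hheight] at h2
    linarith [le_max_right 0 (B - height y + 1)]
  · have h1 := key (Ioc (-height y) 0) isPreconnected_Ioc ⟨by linarith, le_rfl⟩ fun s hs =>
      ⟨by linarith [hs.1], mul_nonneg_of_nonpos_of_nonpos hs.2 (by linarith)⟩
    obtain ⟨z, hzK, hz⟩ := hK.exists_isMinOn ⟨y, hΩK hy⟩ continuous_height.continuousOn
    have hz0 : 0 < height z := hKH hzK
    have hzy : height z ≤ height y := hz (hΩK hy)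
    have h2 : height z ≤ height (y + (height z / 2 - height y) • Eₗ n) :=
      hz (h1 _ ⟨by linarith, by linarith⟩)
    rw [hheight] at h2
    linarith

/-- A ball that the hypersurface does not enter lies on one side of it. -/
theorem ball_subset_or_disjoint_enclosed (hΩ : IsEnclosedDomain x Ω)
    (hext : ∀ q, m ≤ ‖x q - o‖) :
    Metric.ball o m ∩ PPlus n ⊆ Ω ∨ Disjoint (Metric.ball o m ∩ PPlus n) Ω := by
  by_cases h : Disjoint (Metric.ball o m ∩ PPlus n) Ω
  · exact Or.inr h
  · obtain ⟨y, hy, hyΩ⟩ := Set.not_disjoint_iff.1 h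
    refine Or.inl (subset_of_mem_of_disjoint_range hΩ
      ((convex_ball o m).inter convex_PPlus).isPreconnected inter_subset_right ?_ hy hyΩ)
    rw [Set.disjoint_left]
    rintro _ ⟨hz, -⟩ ⟨q, rfl⟩
    rw [mem_ball_iff_norm] at hz
    linarith [hext q]

end EnclosedDomain

/-! ### The normal at an extremal cap -/

section Normal

variable {n : ℕ}

theorem eventually_add_smul_mem_PPlus {y w : Amb n} (hy : 0 < height y)
    (hw : 0 < y 0 ∨ y 0 = 0 ∧ 0 < w 0) : ∀ᶠ s : ℝ in 𝓝[>] 0, y + s • w ∈ PPlus n := by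
  have hc : Continuous fun s : ℝ => height (y + s • w) :=
    continuous_height.comp (by fun_prop)
  have h1 : ∀ᶠ s : ℝ in 𝓝[>] 0, 0 < height (y + s • w) :=
    nhdsWithin_le_nhds (hc.continuousAt.eventually (lt_mem_nhds (by simpa using hy)))
  rcases hw with h | ⟨h, hw⟩
  · have hc0 : Continuous fun s : ℝ => (y + s • w) 0 :=
      continuous_apply_zero.comp (by fun_prop)
    filter_upwards [h1, nhdsWithin_le_nhds
      (hc0.continuousAt.eventually (lt_mem_nhds (by simpa using h)))] with s hs hs'
    exact ⟨hs, hs'⟩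
  · filter_upwards [h1, self_mem_nhdsWithin] with s hs hs'
    have hs' : 0 < s := hs'
    refine ⟨hs, ?_⟩
    simp only [PiLp.add_apply, PiLp.smul_apply, smul_eq_mul, h, zero_add]
    positivity

/-- Two vectors orthogonal to the image of an injective linear map of corank one. -/
theorem exists_eq_smul_of_orthogonal_range (L : EuclideanSpace ℝ (Fin n) →L[ℝ] Amb n)
    (hL : Function.Injective L) {a b : Amb n} (hb : b ≠ 0)
    (ha' : ∀ v, inner ℝ a (L v) = 0) (hb' : ∀ v, inner ℝ b (L v) = 0) :
    ∃ r : ℝ, a = r • b := by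
  set K : Submodule ℝ (Amb n) := LinearMap.range L.toLinearMap with hK
  have hrank : Module.finrank ℝ K = n := by
    rw [hK, LinearMap.finrank_range_of_inj hL]; simp
  have h1 := K.finrank_add_finrank_orthogonal
  have h2 : Module.finrank ℝ Kᗮ = 1 := by
    rw [hrank, finrank_euclideanSpace_fin] at h1
    omega
  have hmem : ∀ y : Amb n, (∀ v, inner ℝ y (L v) = 0) → y ∈ Kᗮ := by
    intro y hy
    rw [Submodule.mem_orthogonal']
    rintro _ ⟨v, rfl⟩
    exact hy v
  obtain ⟨r, hr⟩ := (finrank_eq_one_iff_of_nonzero' (⟨b, hmem b hb'⟩ : Kᗮ)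
    (by simpa using hb)).1 h2 ⟨a, hmem a ha'⟩
  exact ⟨r, (congrArg Subtype.val hr).symm⟩

theorem norm_add_smul_sub_sq (y w o : Amb n) (s : ℝ) :
    ‖y + s • w - o‖ ^ 2 = ‖y - o‖ ^ 2 + s * (2 * inner ℝ (y - o) w + s * ‖w‖ ^ 2) := by
  rw [show y + s • w - o = (y - o) + s • w by abel, norm_add_sq_real, inner_smul_right, norm_smul,
    mul_pow, Real.norm_eq_abs, sq_abs]
  ring

/-- A vector orthogonal to the image of the hyperplane `v₀ = 0` lies in the plane spanned by two
independent such vectors. -/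
theorem exists_eq_add_of_orthogonal_boundary [NeZero n]
    (L : EuclideanSpace ℝ (Fin n) →L[ℝ] Amb n)
    (hL : Function.Injective L) {a b d : Amb n} (hab : LinearIndependent ℝ ![a, b])
    (ha : ∀ v, v 0 = 0 → inner ℝ a (L v) = 0) (hb : ∀ v, v 0 = 0 → inner ℝ b (L v) = 0)
    (hd : ∀ v, v 0 = 0 → inner ℝ d (L v) = 0) :
    ∃ r t : ℝ, r • a + t • b = d := by
  set W : Submodule ℝ (EuclideanSpace ℝ (Fin n)) :=
    LinearMap.ker (EuclideanSpace.proj (𝕜 := ℝ) (0 : Fin n) :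
      EuclideanSpace ℝ (Fin n) →L[ℝ] ℝ).toLinearMap with hW
  have hWmem : ∀ v, v ∈ W ↔ v 0 = 0 := fun v => by rw [hW, LinearMap.mem_ker]; rfl
  have hWrank : Module.finrank ℝ W + 1 = n := by
    have h := LinearMap.finrank_range_add_finrank_ker
      (EuclideanSpace.proj (𝕜 := ℝ) (0 : Fin n) : EuclideanSpace ℝ (Fin n) →L[ℝ] ℝ).toLinearMap
    have hsurj : LinearMap.range (EuclideanSpace.proj (𝕜 := ℝ) (0 : Fin n) :
        EuclideanSpace ℝ (Fin n) →L[ℝ] ℝ).toLinearMap = ⊤ := by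
      rw [LinearMap.range_eq_top]
      intro r
      exact ⟨EuclideanSpace.single 0 r, by simp⟩
    rw [hsurj, finrank_top, Module.finrank_self, finrank_euclideanSpace_fin, ← hW] at h
    omega
  set K : Submodule ℝ (Amb n) := W.map L.toLinearMap with hK
  have hrank : Module.finrank ℝ K = Module.finrank ℝ W :=
    (Submodule.equivMapOfInjective L.toLinearMap hL W).finrank_eq.symm
  have h1 := K.finrank_add_finrank_orthogonal
  have h2 : Module.finrank ℝ Kᗮ = 2 := by
    rw [hrank, finrank_euclideanSpace_fin] at h1
    omega
  have hmem : ∀ y : Amb n, (∀ v, v 0 = 0 → inner ℝ y (L v) = 0) → y ∈ Kᗮ := by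
    intro y hy
    rw [Submodule.mem_orthogonal']
    rintro _ ⟨v, hv, rfl⟩
    exact hy v ((hWmem v).1 hv)
  have hspan : Submodule.span ℝ {a, b} = Kᗮ := by
    refine Submodule.eq_of_le_of_finrank_eq ?_ ?_
    · rw [Submodule.span_le]
      rintro y (rfl | rfl)
      · exact hmem _ ha
      · exact hmem _ hb
    · have := finrank_span_eq_card hab
      rw [Matrix.range_cons, Matrix.range_cons, Matrix.range_empty, union_empty,
        singleton_union] at this
      rw [this, h2, Fintype.card_fin]
  have hd' := hmem d hd
  rw [← hspan, Submodule.mem_span_pair] at hd'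
  exact hd'

variable [NeZero n] {M : Type*} [TopologicalSpace M]
  [ChartedSpace (EuclideanHalfSpace n) M] {x ν : M → Amb n} {c θ m ς : ℝ} {p : M}

/-- At an extremal cap the normal is that of the cap, or it points to the opposite side. -/
theorem normal_dichotomy (hθ : 0 < Real.sin θ) (hς : ς = 1 ∨ ς = -1)
    (hx : IsCapillary θ x ν) (hm : 0 < m)
    (hext : ∀ q, ς * ‖x q - capCenter n c θ m‖ ^ 2 ≤ ς * ‖x p - capCenter n c θ m‖ ^ 2)
    (hpm : ‖x p - capCenter n c θ m‖ = m) :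
    ∃ w : Amb n, (∀ᶠ s : ℝ in 𝓝[>] 0, x p + s • w ∈ PPlus n) ∧
      0 < ς * inner ℝ (x p - capCenter n c θ m) w ∧
      ((0 < ς * inner ℝ w (ν p) ∧ x p - capCenter n c θ m = (m / height (x p)) • ν p) ∨
        (ς * inner ℝ w (ν p) < 0 ∧ inner ℝ (x p - c • Eₗ n) (ν p) < 0)) := by
  have hςne : ς ≠ 0 := by rcases hς with rfl | rfl <;> norm_num
  have hςsq : ς * ς = 1 := by rcases hς with rfl | rfl <;> norm_num
  have hςabs : |ς| = 1 := by rcases hς with rfl | rfl <;> norm_num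
  have hh := hx.height_pos p
  have hn := hx.norm_normal p
  have hx1 : ContMDiff (𝓡∂ n) 𝓘(ℝ, Amb n) 1 x := hx.regular.of_le (by norm_num)
  have hν0 : ν p ≠ 0 := by rw [← norm_pos_iff, hn]; exact hh
  have hνorth : ∀ v : EuclideanSpace ℝ (Fin n), inner ℝ (ν p) (coordDiff x p v) = 0 := fun v => by
    rw [real_inner_comm]; exact hx.inner_diff_normal p v
  have hinj : Function.Injective (coordDiff x p) := hx.immersion p
  set o := capCenter n c θ m with ho
  have hyo : x p - c • Eₗ n = x p - o - (m * Real.cos θ) • E₁ n := by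
    rw [ho, sub_capCenter]; abel
  have hp : p ∈ (𝓡∂ n).interior M ∪ (𝓡∂ n).boundary M := by
    rw [ModelWithCorners.interior_union_boundary_eq_univ]; trivial
  rcases hp with hp | hp
  · obtain ⟨a, ha⟩ := exists_eq_smul_of_orthogonal_range (coordDiff x p) hinj hν0
      (fun v => inner_diff_eq_zero hx1 hςne hext (v := v) (Or.inl hp)) hνorth
    have hP := hx.interior_subset p hp
    have habs : |a| * height (x p) = m := by
      rw [← hpm, ha, norm_smul, hn, Real.norm_eq_abs]
    -- At an interior point the direction normal to the cap serves as `w`, and `ν p` is parallel to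
    -- it; the sign of the factor `a` separates the two cases.
    refine ⟨ς • (x p - o), eventually_add_smul_mem_PPlus hP.1 (Or.inl hP.2), ?_, ?_⟩
    · rw [inner_smul_right, ← mul_assoc, hςsq, one_mul, real_inner_self_eq_norm_sq, hpm]
      positivity
    · have h1 : ς * inner ℝ (ς • (x p - o)) (ν p) = a * height (x p) ^ 2 := by
        rw [inner_smul_left, conj_trivial, ← mul_assoc, hςsq, one_mul, ha, inner_smul_left,
          conj_trivial, real_inner_self_eq_norm_sq, hn]
      rw [h1]
      rcases le_or_gt a 0 with h | h
      · rw [abs_of_nonpos h] at habs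
        have h2 : a < 0 := lt_of_le_of_ne h (by rintro rfl; simp at habs; linarith)
        refine Or.inr ⟨mul_neg_of_neg_of_pos h2 (by positivity), ?_⟩
        rw [hyo, ha, inner_sub_left, inner_smul_left, inner_smul_left, inner_E₁_left,
          real_inner_self_eq_norm_sq, hn]
        simp only [conj_trivial]
        have h3 := cos_mul_lt hθ hh (a := -(ν p 0))
          (by rw [abs_neg, ← hn]; exact abs_apply_zero_le _)
        have h4 : a * height (x p) ^ 2 - m * Real.cos θ * ν p 0
            = m * (Real.cos θ * -(ν p 0) - height (x p)) := by
          rw [← habs]; ring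
        rw [h4]
        exact mul_neg_of_pos_of_neg hm (by linarith)
      · rw [abs_of_pos h] at habs
        refine Or.inl ⟨by positivity, ?_⟩
        rw [ha, ← habs, mul_div_assoc, div_self hh.ne', mul_one]
  · have hP := hx.boundary_subset p hp
    set y := x p - c • Eₗ n with hy
    have hy0 : y 0 = 0 := by simp [hy, hP.2, Eₗ_zero]
    have hoy : x p - o = y + (m * Real.cos θ) • E₁ n := by rw [ho, sub_capCenter]
    have hsc := Real.sin_sq_add_cos_sq θ
    have hyn : ‖y‖ ^ 2 = m ^ 2 * Real.sin θ ^ 2 := by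
      have h := norm_sq_add_E₁ y (m * Real.cos θ)
      rw [← hoy, hpm, hy0] at h
      linear_combination -h - m ^ 2 * hsc
    have hyne : y ≠ 0 := by
      rintro h0
      rw [h0, norm_zero] at hyn
      have : 0 < m ^ 2 * Real.sin θ ^ 2 := by positivity
      linarith
    have hE₁orth : ∀ v : EuclideanSpace ℝ (Fin n), v 0 = 0 →
        inner ℝ (E₁ n) (coordDiff x p v) = 0 := fun v hv => by
      rw [inner_E₁_left]
      exact diff_apply_zero_eq_zero hx1 hP.2 hx.apply_zero_nonneg hv
    have hyorth : ∀ v : EuclideanSpace ℝ (Fin n), v 0 = 0 →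
        inner ℝ y (coordDiff x p v) = 0 := fun v hv => by
      have h : inner ℝ (x p - o) (coordDiff x p v) = 0 :=
        inner_diff_eq_zero hx1 hςne hext (v := v) (Or.inr hv)
      rw [hyo, inner_sub_left, inner_smul_left, hE₁orth v hv, h]
      simp
    have hindep : LinearIndependent ℝ ![E₁ n, y] := by
      rw [LinearIndependent.pair_iff]
      intro r t hrt
      have h0 : r = 0 := by
        have := congrArg (fun z : Amb n => z 0) hrt
        simpa [E₁_zero, hy0] using this
      rw [h0, zero_smul, zero_add] at hrt
      exact ⟨h0, (smul_eq_zero.1 hrt).resolve_right hyne⟩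
    -- At a boundary point the normal lies in the plane spanned by `E₁` and `y`. The contact angle
    -- determines `α` and the length determines `β` up to sign; the two signs are the two
    -- alternatives.
    obtain ⟨α, β, hαβ⟩ := exists_eq_add_of_orthogonal_boundary (coordDiff x p) hinj hindep
      hE₁orth hyorth (fun v _ => hνorth v)
    have hν0' : ν p 0 = α := by
      have := congrArg (fun z : Amb n => z 0) hαβ
      simpa [E₁_zero, hy0] using this.symm
    have hα : α = height (x p) * Real.cos θ := by
      have h := hx.angle p hp
      rw [hypInner, planeNormal, inner_neg_right, inner_smul_right, inner_E₁, hν0'] at h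
      field_simp at h
      linarith
    have hβ : (β * m) ^ 2 = height (x p) ^ 2 := by
      have h : ‖ν p‖ ^ 2 = β ^ 2 * ‖y‖ ^ 2 + α ^ 2 := by
        rw [← hαβ, add_comm (α • E₁ n), norm_sq_add_E₁, norm_smul, Real.norm_eq_abs, mul_pow, sq_abs,
          PiLp.smul_apply, hy0]
        simp
      rw [hn, hyn, hα] at h
      have h5 : Real.sin θ ^ 2 * ((β * m) ^ 2 - height (x p) ^ 2) = 0 := by
        linear_combination -h - height (x p) ^ 2 * hsc
      have h6 := (mul_eq_zero.1 h5).resolve_left (by positivity)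
      linarith
    -- The direction `ς y` is tangent to `P`; adding `η E₁` with `η > 0` moves it into `P₊`. With
    -- this size the correction to each pairing is a factor `1 ± ς cos θ / 2 > 0`, so the signs
    -- remain those given by `ς y`.
    set η := m * Real.sin θ ^ 2 / 2 with hη
    have hη0 : 0 < η := by positivity
    have hsin2 : 0 < Real.sin θ ^ 2 := by positivity
    have hςcos : |ς * Real.cos θ| < 1 := by
      rw [abs_mul, hςabs, one_mul]; exact abs_cos_lt_one hθ
    obtain ⟨hc1, hc2⟩ := abs_lt.1 hςcos
    have hw0 : (ς • y + η • E₁ n) 0 = η := by simp [hy0, E₁_zero]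
    have hcomb : ∀ r t : ℝ, ς * inner ℝ (t • y + r • E₁ n) (ς • y + η • E₁ n)
        = t * (m ^ 2 * Real.sin θ ^ 2) + ς * r * η := by
      intro r t
      have h1 : inner ℝ y y = m ^ 2 * Real.sin θ ^ 2 := by
        rw [real_inner_self_eq_norm_sq, hyn]
      simp only [inner_add_left, inner_add_right, inner_smul_left, inner_smul_right, conj_trivial,
        inner_E₁, inner_E₁_left, h1, hy0, E₁_zero]
      linear_combination t * (m ^ 2 * Real.sin θ ^ 2) * hςsq
    refine ⟨ς • y + η • E₁ n, eventually_add_smul_mem_PPlus hh (Or.inr ⟨hP.2, by rwa [hw0]⟩),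
      ?_, ?_⟩
    · have h := hcomb (m * Real.cos θ) 1
      rw [one_smul, ← hoy] at h
      rw [h, hη]
      have : 1 * (m ^ 2 * Real.sin θ ^ 2) + ς * (m * Real.cos θ) * (m * Real.sin θ ^ 2 / 2)
          = m ^ 2 * Real.sin θ ^ 2 * (1 + ς * Real.cos θ / 2) := by ring
      rw [this]
      have : 0 < 1 + ς * Real.cos θ / 2 := by linarith
      positivity
    · have hi : ς * inner ℝ (ς • y + η • E₁ n) (ν p)
          = β * (m ^ 2 * Real.sin θ ^ 2) + ς * α * η := by
        rw [← hcomb α β, ← hαβ, real_inner_comm, add_comm (β • y)]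
      rw [hi, hα, hη]
      rcases sq_eq_sq_iff_eq_or_eq_neg.1 hβ with h | h
      · refine Or.inl ⟨?_, ?_⟩
        · have : β * (m ^ 2 * Real.sin θ ^ 2)
              + ς * (height (x p) * Real.cos θ) * (m * Real.sin θ ^ 2 / 2)
              = height (x p) * m * Real.sin θ ^ 2 * (1 + ς * Real.cos θ / 2) := by
            rw [← h]
            linear_combination (ς * Real.cos θ * m * Real.sin θ ^ 2 / 2) * (h - h)
          rw [this]
          have : 0 < 1 + ς * Real.cos θ / 2 := by linarith
          positivity
        · rw [hoy, ← hαβ, hα, smul_add, smul_smul, smul_smul, add_comm]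
          have e1 : m / height (x p) * (height (x p) * Real.cos θ) = m * Real.cos θ := by
            field_simp
          have e2 : m / height (x p) * β = 1 := by
            rw [← h]
            have : β * m ≠ 0 := by rw [h]; exact hh.ne'
            rw [div_mul_eq_mul_div, mul_comm, div_self this]
          rw [e1, e2, one_smul]
      · refine Or.inr ⟨?_, ?_⟩
        · have hh' : height (x p) = -(β * m) := by linarith
          have : β * (m ^ 2 * Real.sin θ ^ 2)
              + ς * (height (x p) * Real.cos θ) * (m * Real.sin θ ^ 2 / 2)
              = -(height (x p) * m * Real.sin θ ^ 2 * (1 - ς * Real.cos θ / 2)) := by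
            rw [hh']; ring
          rw [this, neg_lt_zero]
          have : 0 < 1 - ς * Real.cos θ / 2 := by linarith
          positivity
        · rw [← hαβ, inner_add_right, inner_smul_right, inner_smul_right, inner_E₁, hy0,
            real_inner_self_eq_norm_sq, mul_zero, zero_add]
          have hβneg : β < 0 := by
            by_contra! hnn
            have := mul_nonneg hnn hm.le
            linarith
          exact mul_neg_of_neg_of_pos hβneg (by rw [hyn]; positivity)

/-- At the smallest cap containing the hypersurface the normals agree. -/
theorem normal_eq_of_max (hθ : 0 < Real.sin θ) (hx : IsCapillary θ x ν) (hm : 0 < m)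
    (hext : ∀ q, ‖x q - capCenter n c θ m‖ ≤ m) (hpm : ‖x p - capCenter n c θ m‖ = m) :
    x p - capCenter n c θ m = (m / height (x p)) • ν p := by
  obtain ⟨w, hwP, hw, h⟩ := normal_dichotomy (ς := 1) hθ (Or.inl rfl) hx hm
    (fun q => by rw [hpm, one_mul, one_mul]; exact pow_le_pow_left₀ (norm_nonneg _) (hext q) 2) hpm
  rcases h with h | h
  · exact h.2
  · obtain ⟨Ω, hΩ, hout⟩ := hx.normal.outer
    have hh := hx.height_pos p
    have h1 : hypInner (x p) w (ν p) < 0 :=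
      div_neg_of_neg_of_pos (by linarith [h.1]) (by positivity)
    -- With the opposite normal, the segment along `w` would enter the domain while leaving the ball
    -- that contains it.
    obtain ⟨s, hsΩ, hs⟩ := (((hout p w hwP).1 h1).and self_mem_nhdsWithin).exists
    have hs : 0 < s := hs
    have h2 := norm_sub_le_of_mem_enclosed hΩ hm.le hext hsΩ
    have h3 := norm_add_smul_sub_sq (x p) w (capCenter n c θ m) s
    have h4 := pow_le_pow_left₀ (norm_nonneg _) h2 2
    rw [hpm] at h3
    have h5 : 0 < s * (2 * inner ℝ (x p - capCenter n c θ m) w + s * ‖w‖ ^ 2) := by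
      have : 0 < inner ℝ (x p - capCenter n c θ m) w := by linarith
      positivity
    linarith

/-- At the largest cap that the hypersurface does not enter, the normal is that of the cap at all
points of contact, or it points to the opposite side at all of them. -/
theorem normal_alternative_of_min (hθ : 0 < Real.sin θ) (hx : IsCapillary θ x ν) (hm : 0 < m)
    (hext : ∀ q, m ≤ ‖x q - capCenter n c θ m‖) :
    ∃ inside : Prop, ∀ p, ‖x p - capCenter n c θ m‖ = m →
      (inside ∧ 0 < inner ℝ (x p - c • Eₗ n) (ν p) ∧
        x p - capCenter n c θ m = (m / height (x p)) • ν p) ∨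
      (¬ inside ∧ inner ℝ (x p - c • Eₗ n) (ν p) < 0) := by
  obtain ⟨Ω, hΩ, hout⟩ := hx.normal.outer
  set o := capCenter n c θ m with ho
  -- This proposition does not depend on `p`, so all contact points fall under the same alternative.
  -- A short segment from `p` into the ball decides which one.
  refine ⟨Metric.ball o m ∩ PPlus n ⊆ Ω, fun p hpm => ?_⟩
  have hh := hx.height_pos p
  obtain ⟨w, hwP, hw, h⟩ := normal_dichotomy (ς := -1) hθ (Or.inr rfl) hx hm
    (fun q => by rw [← ho, hpm]; linarith [pow_le_pow_left₀ hm.le (hext q) 2]) hpm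
  rw [← ho] at hw h
  have hball : ∀ᶠ s : ℝ in 𝓝[>] 0, x p + s • w ∈ Metric.ball o m ∩ PPlus n := by
    have hc : Continuous fun s : ℝ => 2 * inner ℝ (x p - o) w + s * ‖w‖ ^ 2 := by fun_prop
    have h1 : ∀ᶠ s : ℝ in 𝓝[>] 0, 2 * inner ℝ (x p - o) w + s * ‖w‖ ^ 2 < 0 :=
      nhdsWithin_le_nhds (hc.continuousAt.eventually (gt_mem_nhds (by simp; linarith)))
    filter_upwards [h1, hwP, self_mem_nhdsWithin] with s hs hsP hs0
    refine ⟨?_, hsP⟩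
    have h2 := norm_add_smul_sub_sq (x p) w o s
    rw [hpm] at h2
    have h3 := mul_neg_of_pos_of_neg (show 0 < s from hs0) hs
    rw [mem_ball_iff_norm]
    exact lt_of_pow_lt_pow_left₀ 2 hm.le (by linarith)
  rcases h with ⟨h1, h2⟩ | ⟨h1, h2⟩
  · refine Or.inl ⟨?_, ?_, h2⟩
    · have h3 : hypInner (x p) w (ν p) < 0 :=
        div_neg_of_neg_of_pos (by linarith) (by positivity)
      obtain ⟨s, hsΩ, hsB⟩ := (((hout p w hwP).1 h3).and hball).exists
      exact (ball_subset_or_disjoint_enclosed hΩ hext).resolve_right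
        (Set.not_disjoint_iff.2 ⟨_, hsB, hsΩ⟩)
    · obtain ⟨h3, h4⟩ := inner_normal_of_eq hθ hx hm h2
      rw [h3]
      positivity
  · refine Or.inr ⟨fun hsub => ?_, h2⟩
    have h3 : 0 < hypInner (x p) w (ν p) := div_pos (by linarith) (by positivity)
    obtain ⟨s, hsΩ, hsB⟩ := (((hout p w hwP).2 h3).and hball).exists
    exact hsΩ (hsub hsB)

end Normal

/-! ### Umbilical caps as barriers for the flow -/

section Contact

variable {n : ℕ} {c θ m : ℝ}

theorem mem_cap_iff (hθ : 0 < Real.sin θ) (hm : 0 < m) {y : Amb n} (hy : y ∈ Hyp n)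
    (hy0 : 0 ≤ y 0) : y ∈ cap c m θ 0 ↔ capRadius θ (y - c • Eₗ n) ≤ m := by
  rw [capRadius_le_iff hθ hm, cap, mem_ofPred_eq,
    show y + (m * Real.cos θ) • E₁ n - 0 - c • Eₗ n = y - c • Eₗ n + (m * Real.cos θ) • E₁ n by
      abel]
  exact ⟨fun h => h.2.1, fun h => ⟨hy, h, hy0⟩⟩

theorem norm_sub_capCenter_of_eq (hθ : 0 < Real.sin θ) {y : Amb n} (hm : 0 < m)
    (hy : capRadius θ (y - c • Eₗ n) = m) : ‖y - capCenter n c θ m‖ = m := by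
  have := norm_add_capRadius hθ (y := y - c • Eₗ n) (by rw [hy]; exact hm)
  rwa [hy, ← sub_capCenter] at this

theorem le_norm_sub_capCenter (hθ : 0 < Real.sin θ) {y : Amb n} (hm : 0 < m)
    (hy : m ≤ capRadius θ (y - c • Eₗ n)) : m ≤ ‖y - capCenter n c θ m‖ := by
  rw [sub_capCenter]
  exact not_lt.1 fun hlt => absurd ((capRadius_lt_iff hθ hm _).2 hlt) (not_lt.2 hy)

end Contact

/-! ### Minimisers in space-time and first times. -/

section FirstTime

variable {M : Type*} [TopologicalSpace M] {b : ℝ}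

/-- Projected to the time axis, this yields the closed sets of times at which some spatial minimiser
has a given sign of `σ`. -/
theorem isCompact_minimizers [CompactSpace M] {φ : ℝ × M → ℝ}
    (hφ : ContinuousOn φ (Icc 0 b ×ˢ univ)) {σ : ℝ × M → ℝ}
    (hσ : ContinuousOn σ (Icc 0 b ×ˢ univ)) :
    IsCompact {y ∈ Icc 0 b ×ˢ (univ : Set M) | (∀ q, φ y ≤ φ (y.1, q)) ∧ 0 ≤ σ y} := by
  have hD : IsClosed (Icc 0 b ×ˢ (univ : Set M)) := isClosed_Icc.prod isClosed_univ
  have h1 : ∀ q : M, IsClosed ((Icc 0 b ×ˢ (univ : Set M)) ∩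
      (fun y : ℝ × M => φ (y.1, q) - φ y) ⁻¹' Ici 0) := fun q =>
    ((hφ.comp (by fun_prop : Continuous fun y : ℝ × M => (y.1, q)).continuousOn
      fun y hy => ⟨hy.1, trivial⟩).sub hφ).preimage_isClosed_of_isClosed hD isClosed_Ici
  have h2 : IsClosed ((Icc 0 b ×ˢ (univ : Set M)) ∩ σ ⁻¹' Ici 0) :=
    hσ.preimage_isClosed_of_isClosed hD isClosed_Ici
  refine (isCompact_Icc.prod isCompact_univ).of_isClosed_subset
    (s := Icc (0 : ℝ) b ×ˢ (univ : Set M)) ?_ fun y hy => hy.1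
  have h3 : {y ∈ Icc 0 b ×ˢ (univ : Set M) | (∀ q, φ y ≤ φ (y.1, q)) ∧ 0 ≤ σ y}
      = ((Icc 0 b ×ˢ (univ : Set M)) ∩ σ ⁻¹' Ici 0) ∩
        ⋂ q : M, ((Icc 0 b ×ˢ (univ : Set M)) ∩
          (fun y : ℝ × M => φ (y.1, q) - φ y) ⁻¹' Ici 0) := by
    ext y
    simp only [mem_sep_iff, mem_inter_iff, mem_iInter, mem_preimage, mem_Ici, sub_nonneg]
    exact ⟨fun h => ⟨⟨h.1, h.2.2⟩, fun q => ⟨h.1, h.2.1 q⟩⟩,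
      fun h => ⟨h.1.1, fun q => (h.2 q).2, h.1.2⟩⟩
  rw [h3]
  exact h2.inter (isClosed_iInter h1)

/-- The first time at which a function that is initially larger than `a` attains a value
`≤ a`. -/
theorem exists_first_time [CompactSpace M] {a : ℝ} {φ : ℝ × M → ℝ}
    (hφ : ContinuousOn φ (Icc 0 b ×ˢ univ)) (h0 : ∀ q, a < φ (0, q))
    (hle : ∃ s ∈ Icc 0 b, ∃ q, φ (s, q) ≤ a) :
    ∃ t ∈ Icc 0 b, ∃ q, φ (t, q) ≤ a ∧ ∀ s ∈ Icc 0 t, ∀ y, a ≤ φ (s, y) := by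
  have hbad : IsCompact (Prod.fst '' ((Icc 0 b ×ˢ (univ : Set M)) ∩ φ ⁻¹' Iic a)) :=
    ((isCompact_Icc.prod isCompact_univ).of_isClosed_subset (hφ.preimage_isClosed_of_isClosed
      (isClosed_Icc.prod isClosed_univ) isClosed_Iic) inter_subset_left).image continuous_fst
  obtain ⟨s₀, hs₀, q₀, hq₀⟩ := hle
  obtain ⟨t, ⟨⟨t', q⟩, ⟨⟨htI, -⟩, htq⟩, htt⟩, hleast⟩ :=
    hbad.exists_isLeast ⟨s₀, (s₀, q₀), ⟨⟨hs₀, trivial⟩, hq₀⟩, rfl⟩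
  have htt : t' = t := htt
  subst htt
  have htI : t' ∈ Icc 0 b := htI
  have htq : φ (t', q) ≤ a := htq
  have hpos : 0 < t' := by
    rcases htI.1.eq_or_lt with h | h
    · rw [← h] at htq
      linarith [h0 q]
    · exact h
  have hlt : ∀ s ∈ Ico 0 t', ∀ y, a < φ (s, y) := by
    intro s hs y
    by_contra! hle
    have h1 : t' ≤ s := hleast ⟨(s, y), ⟨⟨⟨hs.1, hs.2.le.trans htI.2⟩, trivial⟩, hle⟩, rfl⟩
    exact absurd hs.2 (not_lt.2 h1)
  refine ⟨t', htI, q, htq, fun s hs y => ?_⟩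
  rcases hs.2.eq_or_lt with h | h
  -- At the first time itself the lower bound follows from continuity from the left.
  · have hc : ContinuousOn (fun s => φ (s, y)) (Icc 0 b) :=
      hφ.comp (by fun_prop : Continuous fun s : ℝ => (s, y)).continuousOn
        fun s hs => ⟨hs, trivial⟩
    have htend : Tendsto (fun s => φ (s, y)) (𝓝[<] t') (𝓝 (φ (t', y))) :=
      (hc t' htI).tendsto.mono_left (nhdsWithin_le_of_mem
        (mem_of_superset (Ioo_mem_nhdsLT hpos) fun s hs => ⟨hs.1.le, hs.2.le.trans htI.2⟩))
    rw [h]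
    refine ge_of_tendsto htend ?_
    filter_upwards [Ioo_mem_nhdsLT hpos] with s hs using (hlt s ⟨hs.1.le, hs.2⟩ y).le
  · exact (hlt s ⟨hs.1, h⟩ y).le

end FirstTime

/-! ### Preservation of the outer and inner caps along the flow. -/

section Flow

variable {n : ℕ} [NeZero n] {M : Type*} [TopologicalSpace M]
  [ChartedSpace (EuclideanHalfSpace n) M] {c θ b m ς : ℝ} {T : EReal} {x ν : ℝ → M → Amb n}

theorem IsFlow.continuousOn (hx : IsFlow c θ T x ν) :
    ContinuousOn (Function.uncurry x) (timeInterval T ×ˢ univ) :=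
  hx.regular.continuousOn

theorem IsFlow.continuousOn_capRadius (hx : IsFlow c θ T x ν) :
    ContinuousOn (fun y : ℝ × M => capRadius θ (x y.1 y.2 - c • Eₗ n))
      (timeInterval T ×ˢ univ) :=
  (continuous_capRadius θ).comp_continuousOn (hx.continuousOn.sub continuousOn_const)

theorem IsFlow.hasDerivWithinAt (hx : IsFlow c θ T x ν) {t : ℝ} (ht : t ∈ timeInterval T) (p : M) :
    HasDerivWithinAt (fun s => x s p) (derivWithin (fun s => x s p) (timeInterval T) t)
      (timeInterval T) t := by
  have h1 : ContMDiffOn 𝓘(ℝ, ℝ) (𝓘(ℝ, ℝ).prod (𝓡∂ n)) 1 (fun s : ℝ => (s, p))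
      (timeInterval T) := contMDiffOn_id.prodMk contMDiffOn_const
  have h2 : ContMDiffOn 𝓘(ℝ, ℝ) 𝓘(ℝ, Amb n) 1 (fun s => x s p) (timeInterval T) :=
    hx.regular.comp h1 fun s hs => ⟨hs, trivial⟩
  exact (h2.contDiffOn.differentiableOn (by norm_num) t ht).hasDerivWithinAt

theorem IsFlow.inner_deriv (hx : IsFlow c θ T x ν) {t : ℝ} (ht : t ∈ timeInterval T) (p : M) :
    inner ℝ (derivWithin (fun s => x s p) (timeInterval T) t) (ν t p)
      = normalSpeed c θ (x t) (ν t) p * height (x t p) ^ 2 := by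
  have hcap := hx.capillary t ht
  have hh := hcap.height_pos p
  have hν : ν t p ≠ 0 := by rw [← norm_pos_iff, hcap.norm_normal]; exact hh
  have h := smul_left_injective ℝ hν (hx.evolution t ht p)
  rwa [hypInner, div_eq_iff (by positivity)] at h

/-- At a time when an extremal cap touches the hypersurface with the same normal, its radius
cannot have been moving outwards (`ς = 1`) or inwards (`ς = -1`) at a positive rate. -/
theorem not_barrier_of_normal_eq [IsManifold (𝓡∂ n) ∞ M] (hθ : 0 < Real.sin θ)
    (hς : ς = 1 ∨ ς = -1) (hx : IsFlow c θ T x ν) {τ ε : ℝ} (hτ : 0 < τ)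
    (hτT : τ ∈ timeInterval T) (hε : 0 < ε) {p : M} (hm : 0 < m)
    (hpm : capRadius θ (x τ p - c • Eₗ n) = m)
    (hext : ∀ q, ς * ‖x τ q - capCenter n c θ m‖ ^ 2 ≤ ς * ‖x τ p - capCenter n c θ m‖ ^ 2)
    (hN : x τ p - capCenter n c θ m = (m / height (x τ p)) • ν τ p) :
    ¬ ∀ s ∈ Icc 0 τ, ς * capRadius θ (x s p - c • Eₗ n)
      ≤ ς * capRadius θ (x τ p - c • Eₗ n) - ε * (τ - s) := by
  intro hbar
  have hcap := hx.capillary τ hτT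
  have hh := hcap.height_pos p
  have hςsq : ς * ς = 1 := by rcases hς with rfl | rfl <;> norm_num
  have hq := normalSpeed_at_extremum hθ hcap hm hext hN
  set V := derivWithin (fun s => x s p) (timeInterval T) τ with hV
  have hxd : HasDerivWithinAt (fun s => x s p) V (Iic τ) τ :=
    (hx.hasDerivWithinAt hτT p).mono_of_mem_nhdsWithin
      (mem_of_superset (Icc_mem_nhdsLE hτ) (Icc_subset_timeInterval hτT))
  set r : ℝ → ℝ := fun s => m - ς * ε * (τ - s) with hr
  have hrd : HasDerivAt r (ς * ε) τ := by
    have h := (((hasDerivAt_id τ).const_sub τ).const_mul (ς * ε)).const_sub m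
    exact h.congr_deriv (by ring)
  have hrτ : r τ = m := by simp [hr]
  have hYd : HasDerivWithinAt (fun s => x s p - c • Eₗ n + (r s * Real.cos θ) • E₁ n)
      (V + (ς * ε * Real.cos θ) • E₁ n) (Iic τ) τ :=
    (hxd.sub_const _).add ((hrd.mul_const _).smul_const _).hasDerivWithinAt
  have hkd := (hYd.norm_sq.sub (hrd.hasDerivWithinAt.pow 2)).const_mul ς
  have hYτ : x τ p - c • Eₗ n + (r τ * Real.cos θ) • E₁ n = x τ p - capCenter n c θ m := by
    rw [hrτ, sub_capCenter]
  have hnorm : ‖x τ p - capCenter n c θ m‖ = m := norm_sub_capCenter_of_eq hθ hm hpm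
  have hrpos : ∀ᶠ s in 𝓝[<] τ, 0 < r s :=
    nhdsWithin_le_nhds (hrd.continuousAt.eventually (lt_mem_nhds (by rw [hrτ]; exact hm)))
  have hle := le_deriv_left_of_barrier (ε := 0) hkd (by
    filter_upwards [hrpos, Ioo_mem_nhdsLT hτ] with s hs hsτ
    have h1 := hbar s ⟨hsτ.1.le, hsτ.2.le⟩
    rw [hpm] at h1
    simp only [Pi.sub_apply, Pi.pow_apply]
    rw [hYτ, hrτ, hnorm, sub_self, mul_zero, zero_mul, sub_zero]
    rcases hς with rfl | rfl
    · have h2 := (capRadius_le_iff hθ hs (x s p - c • Eₗ n)).1 (by simp only [hr]; linarith)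
      have := pow_le_pow_left₀ (norm_nonneg _) h2 2
      linarith
    · have h2 : r s ≤ ‖x s p - c • Eₗ n + (r s * Real.cos θ) • E₁ n‖ := not_lt.1 fun hlt =>
        absurd ((capRadius_lt_iff hθ hs (x s p - c • Eₗ n)).2 hlt)
          (not_lt.2 (by simp only [hr]; linarith))
      have := pow_le_pow_left₀ hs.le h2 2
      linarith)
  rw [hYτ, hrτ, inner_add_right, inner_smul_right, inner_E₁] at hle
  have h0 : (x τ p - capCenter n c θ m) 0 * Real.cos θ < m := by
    rw [mul_comm]
    exact cos_mul_lt hθ hm ((abs_apply_zero_le _).trans hnorm.le)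
  have hVin : ς * inner ℝ (x τ p - capCenter n c θ m) V ≤ 0 := by
    rw [hN, inner_smul_left, conj_trivial, real_inner_comm, hx.inner_deriv hτT p]
    have h1 := mul_nonpos_of_nonpos_of_nonneg hq
      (by positivity : 0 ≤ m / height (x τ p) * height (x τ p) ^ 2)
    linarith
  have h2 : ς * (2 * (inner ℝ (x τ p - capCenter n c θ m) V
      + ς * ε * Real.cos θ * (x τ p - capCenter n c θ m) 0)
      - (2 : ℕ) * m ^ (2 - 1) * (ς * ε))
      = 2 * (ς * inner ℝ (x τ p - capCenter n c θ m) V)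
        + (ς * ς) * (2 * ε * ((x τ p - capCenter n c θ m) 0 * Real.cos θ - m)) := by
    norm_num
    ring
  rw [h2, hςsq] at hle
  -- The centre of the moving cap drifts by `cos θ` times the change of radius, which cannot
  -- compensate the growth of the radius since `|cos θ| < 1`.
  have h3 : ε * ((x τ p - capCenter n c θ m) 0 * Real.cos θ - m) < 0 :=
    mul_neg_of_pos_of_neg hε (by linarith)
  linarith

/-- A cap that contains the initial hypersurface contains it at all times. -/
theorem IsFlow.capRadius_le [IsManifold (𝓡∂ n) ∞ M] [CompactSpace M] (hθ : 0 < Real.sin θ)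
    (hx : IsFlow c θ T x ν) (hm : 0 < m) (h0 : ∀ p, capRadius θ (x 0 p - c • Eₗ n) ≤ m)
    {t : ℝ} (ht : t ∈ timeInterval T) (p : M) : capRadius θ (x t p - c • Eₗ n) ≤ m := by
  have hsub := Icc_subset_timeInterval ht
  refine le_of_forall_max_not_barrier (isCompact_univ (X := M))
    (φ := fun t p => capRadius θ (x t p - c • Eₗ n))
    (hx.continuousOn_capRadius.mono (prod_mono_left hsub)) (fun p _ => h0 p) ?_ t ⟨ht.1, le_rfl⟩
    p trivial
  intro ε hε τ hτ q _ hlt hmax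
  have hτT : τ ∈ timeInterval T := hsub ⟨hτ.1.le, hτ.2⟩
  set r := capRadius θ (x τ q - c • Eₗ n) with hr
  -- Only maxima above `m > 0` matter, so the contact cap is never degenerate.
  have hr0 : 0 < r := hm.trans hlt
  have hext : ∀ y, ‖x τ y - capCenter n c θ r‖ ≤ r := fun y => by
    rw [sub_capCenter]
    exact (capRadius_le_iff hθ hr0 _).1 (hmax y trivial)
  have heq : ‖x τ q - capCenter n c θ r‖ = r := by
    rw [sub_capCenter]
    exact norm_add_capRadius hθ hr0
  have hN := normal_eq_of_max hθ (hx.capillary τ hτT) hr0 hext heq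
  have := not_barrier_of_normal_eq hθ (Or.inl rfl) hx hτ.1 hτT hε hr0 hr.symm
    (fun y => by
      rw [heq, one_mul, one_mul]
      exact pow_le_pow_left₀ (norm_nonneg _) (hext y) 2) hN
  simpa only [one_mul] using this

/-- As long as the hypersurface does not reach `c E_{n+1}`, the outer normal at the points of
contact with the largest cap that it does not enter is the normal of the cap. -/
theorem IsFlow.normal_eq_of_min [CompactSpace M] [Nonempty M] (hθ : 0 < Real.sin θ)
    (hx : IsFlow c θ T x ν) (hstar : IsStarShaped c (x 0) (ν 0)) (hb : b ∈ timeInterval T)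
    (hpos : ∀ t ∈ Icc 0 b, ∀ p, 0 < capRadius θ (x t p - c • Eₗ n)) {t : ℝ} (ht : t ∈ Icc 0 b)
    {p : M} (hp : ∀ q, capRadius θ (x t p - c • Eₗ n) ≤ capRadius θ (x t q - c • Eₗ n)) :
    x t p - capCenter n c θ (capRadius θ (x t p - c • Eₗ n))
      = (capRadius θ (x t p - c • Eₗ n) / height (x t p)) • ν t p := by
  have hsub := Icc_subset_timeInterval hb
  set φ : ℝ × M → ℝ := fun y => capRadius θ (x y.1 y.2 - c • Eₗ n) with hφdef
  set σ : ℝ × M → ℝ := fun y => inner ℝ (x y.1 y.2 - c • Eₗ n) (ν y.1 y.2) with hσdef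
  have hφ : ContinuousOn φ (Icc 0 b ×ˢ univ) :=
    hx.continuousOn_capRadius.mono (prod_mono_left hsub)
  have hσ : ContinuousOn σ (Icc 0 b ×ˢ univ) :=
    ((hx.continuousOn.sub continuousOn_const).inner hx.normal_continuous).mono
      (prod_mono_left hsub)
  -- At each time all spatial minimisers share one sign of `σ`, and `σ` does not vanish at them.
  have halt : ∀ s ∈ Icc 0 b, ∃ inside : Prop, ∀ q, (∀ q', φ (s, q) ≤ φ (s, q')) →
      (inside ∧ 0 < σ (s, q) ∧ x s q - capCenter n c θ (φ (s, q))
        = (φ (s, q) / height (x s q)) • ν s q) ∨ (¬ inside ∧ σ (s, q) < 0) := by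
    intro s hs
    by_cases hex : ∃ q, ∀ q', φ (s, q) ≤ φ (s, q')
    · obtain ⟨q₀, hq₀⟩ := hex
      have hm0 : 0 < φ (s, q₀) := hpos s hs q₀
      obtain ⟨inside, h⟩ := normal_alternative_of_min (c := c) hθ (hx.capillary s (hsub hs)) hm0
        (fun q' => le_norm_sub_capCenter hθ hm0 (hq₀ q'))
      refine ⟨inside, fun q hq => ?_⟩
      have heq : φ (s, q) = φ (s, q₀) := le_antisymm (hq q₀) (hq₀ q)
      rw [heq]
      exact h q (norm_sub_capCenter_of_eq hθ hm0 heq)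
    · exact ⟨True, fun q hq => absurd ⟨q, hq⟩ hex⟩
  -- The times with a minimiser where `σ ≥ 0`, and in `B` those where `σ ≤ 0`, form closed sets that
  -- cover the interval and are disjoint by `halt`. Star-shapedness puts `0` in `A`, so
  -- connectedness leaves `B` empty.
  set A := Prod.fst '' {y ∈ Icc 0 b ×ˢ (univ : Set M) | (∀ q, φ y ≤ φ (y.1, q)) ∧ 0 ≤ σ y} with hA
  set B := Prod.fst '' {y ∈ Icc 0 b ×ˢ (univ : Set M) | (∀ q, φ y ≤ φ (y.1, q)) ∧ 0 ≤ -σ y}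
    with hB
  have hAc : IsClosed A := ((isCompact_minimizers hφ hσ).image continuous_fst).isClosed
  have hBc : IsClosed B := ((isCompact_minimizers hφ hσ.neg).image continuous_fst).isClosed
  have hmin : ∀ s ∈ Icc 0 b, ∃ q, ∀ q', φ (s, q) ≤ φ (s, q') := by
    intro s hs
    obtain ⟨q, -, hq⟩ := (isCompact_univ (X := M)).exists_isMinOn univ_nonempty
      (hφ.comp (by fun_prop : Continuous fun q : M => (s, q)).continuousOn
        fun q _ => ⟨hs, trivial⟩)
    exact ⟨q, fun q' => hq (mem_univ q')⟩
  have hcover : Icc 0 b ⊆ A ∪ B := by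
    intro s hs
    obtain ⟨q, hq⟩ := hmin s hs
    rcases le_total 0 (σ (s, q)) with h | h
    · exact Or.inl ⟨(s, q), ⟨⟨hs, trivial⟩, hq, h⟩, rfl⟩
    · exact Or.inr ⟨(s, q), ⟨⟨hs, trivial⟩, hq, by linarith⟩, rfl⟩
  have hdisj : ¬ (Icc 0 b ∩ (A ∩ B)).Nonempty := by
    rintro ⟨s, hs, ⟨⟨s₁, q₁⟩, ⟨-, hq₁, h₁⟩, rfl⟩, ⟨⟨s₂, q₂⟩, ⟨-, hq₂, h₂⟩, h₁₂⟩⟩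
    have h₁₂ : s₂ = s₁ := h₁₂
    subst h₁₂
    obtain ⟨inside, h⟩ := halt s₂ hs
    rcases h q₁ hq₁ with h3 | h3 <;> rcases h q₂ hq₂ with h4 | h4
    · linarith [h4.2.1]
    · exact h4.1 h3.1
    · exact h3.1 h4.1
    · linarith [h3.2]
  have hb0 : (0 : ℝ) ≤ b := ht.1.trans ht.2
  have h0 : (Icc 0 b ∩ A).Nonempty := by
    have h0mem : (0 : ℝ) ∈ Icc 0 b := ⟨le_rfl, hb0⟩
    obtain ⟨q, hq⟩ := hmin 0 h0mem
    refine ⟨0, h0mem, (0, q), ⟨⟨h0mem, trivial⟩, hq, ?_⟩, rfl⟩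
    have hh := (hx.capillary 0 (hsub h0mem)).height_pos q
    have h := hstar q
    rw [hypInner, div_pos_iff_of_pos_right (by positivity)] at h
    exact h.le
  have hB0 : ¬ (Icc 0 b ∩ B).Nonempty := fun hne =>
    hdisj (isPreconnected_closed_iff.1 isPreconnected_Icc A B hAc hBc hcover h0 hne)
  obtain ⟨inside, h⟩ := halt t ht
  rcases h p hp with h1 | h1
  · exact h1.2.2
  · exact absurd ⟨t, ht, (t, p), ⟨⟨ht, trivial⟩, hp, by linarith [h1.2]⟩, rfl⟩ hB0

/-- The lower barrier under the assumption that `c E_{n+1}` is not reached, which makes the contact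
caps nondegenerate and fixes the orientation of the normal. -/
theorem IsFlow.le_capRadius_of_pos [IsManifold (𝓡∂ n) ∞ M] [CompactSpace M] [Nonempty M]
    (hθ : 0 < Real.sin θ) (hx : IsFlow c θ T x ν) (hstar : IsStarShaped c (x 0) (ν 0))
    (hb : b ∈ timeInterval T)
    (hpos : ∀ t ∈ Icc 0 b, ∀ p, 0 < capRadius θ (x t p - c • Eₗ n))
    (h0 : ∀ p, m ≤ capRadius θ (x 0 p - c • Eₗ n)) {t : ℝ} (ht : t ∈ Icc 0 b) (p : M) :
    m ≤ capRadius θ (x t p - c • Eₗ n) := by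
  have hsub := Icc_subset_timeInterval hb
  refine neg_le_neg_iff.1 (le_of_forall_max_not_barrier (isCompact_univ (X := M)) (m := -m)
    (φ := fun t p => -capRadius θ (x t p - c • Eₗ n))
    (hx.continuousOn_capRadius.mono (prod_mono_left hsub)).neg
    (fun p _ => neg_le_neg (h0 p)) ?_ t ht p trivial)
  intro ε hε τ hτ q _ _ hmax
  have hτI : τ ∈ Icc 0 b := ⟨hτ.1.le, hτ.2⟩
  have hr0 := hpos τ hτI q
  have hmin : ∀ y, capRadius θ (x τ q - c • Eₗ n) ≤ capRadius θ (x τ y - c • Eₗ n) :=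
    fun y => neg_le_neg_iff.1 (hmax y trivial)
  have hN := hx.normal_eq_of_min hθ hstar hb hpos hτI hmin
  have := not_barrier_of_normal_eq hθ (Or.inr rfl) hx hτ.1 (hsub hτI) hε hr0 rfl
    (fun y => by
      rw [norm_sub_capCenter_of_eq (y := x τ q) hθ hr0 rfl]
      linarith [pow_le_pow_left₀ hr0.le (le_norm_sub_capCenter hθ hr0 (hmin y)) 2]) hN
  simpa only [neg_one_mul] using this

/-- A cap that the initial star-shaped hypersurface avoids is avoided at all times. -/
theorem IsFlow.lt_capRadius [IsManifold (𝓡∂ n) ∞ M] [CompactSpace M] [Nonempty M]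
    (hθ : 0 < Real.sin θ) (hx : IsFlow c θ T x ν) (hstar : IsStarShaped c (x 0) (ν 0))
    (hm : 0 < m) (h0 : ∀ p, m < capRadius θ (x 0 p - c • Eₗ n))
    {t : ℝ} (ht : t ∈ timeInterval T) (p : M) : m < capRadius θ (x t p - c • Eₗ n) := by
  have hsub := Icc_subset_timeInterval ht
  have hφ : ContinuousOn (fun y : ℝ × M => capRadius θ (x y.1 y.2 - c • Eₗ n))
      (Icc 0 t ×ˢ univ) := hx.continuousOn_capRadius.mono (prod_mono_left hsub)
  have h0mem : (0 : ℝ) ∈ Icc 0 t := ⟨le_rfl, ht.1⟩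
  obtain ⟨q₀, -, hq₀⟩ := (isCompact_univ (X := M)).exists_isMinOn univ_nonempty
    (hφ.comp (by fun_prop : Continuous fun q : M => ((0 : ℝ), q)).continuousOn
      fun q _ => ⟨h0mem, trivial⟩)
  set m₀ := capRadius θ (x 0 q₀ - c • Eₗ n) with hm₀
  have hm0 : ∀ q, m₀ ≤ capRadius θ (x 0 q - c • Eₗ n) := fun q => hq₀ (mem_univ q)
  have hmm₀ : m < m₀ := h0 q₀
  have hm₀pos : 0 < m₀ := hm.trans hmm₀
  -- Any level strictly between `0` and the initial minimum `m₀` would do. Up to the first time at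
  -- which the level `m₀ / 2` is reached, the function is positive, so the conditional bound gives
  -- at least `m₀` there, a contradiction. Compactness provides `m < m₀`, which keeps the final
  -- inequality strict.
  by_cases hgood : ∀ s ∈ Icc 0 t, ∀ q, m₀ / 2 < capRadius θ (x s q - c • Eₗ n)
  · exact hmm₀.trans_le (hx.le_capRadius_of_pos hθ hstar ht
      (fun s hs q => (half_pos hm₀pos).trans (hgood s hs q)) hm0 ⟨ht.1, le_rfl⟩ p)
  · exfalso
    push Not at hgood
    obtain ⟨b, hb, q, hbq, hge⟩ := exists_first_time hφ
      (fun q => (half_lt_self hm₀pos).trans_le (hm0 q)) hgood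
    have := hx.le_capRadius_of_pos hθ hstar (hsub hb)
      (fun s hs y => (half_pos hm₀pos).trans_le (hge s hs y)) hm0 ⟨hb.1, le_rfl⟩ q
    linarith

end Flow

end HypCapillary

/-! ### The main theorem. -/

theorem propositionC0 (n : ℕ) [NeZero n] (c θ : ℝ) (hc : 0 < c) (hθ : 0 < θ)
    (hθ' : θ < Real.pi) :
    -- the region between two umbilical caps is preserved along the flow
    (∀ (M : Type*) [TopologicalSpace M] [ChartedSpace (EuclideanHalfSpace n) M]
        [IsManifold (𝓡∂ n) ∞ M] [CompactSpace M] [ConnectedSpace M]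
        (T : EReal) (x ν : ℝ → M → Amb n),
        0 < T → IsFlow c θ T x ν → IsStarShaped c (x 0) (ν 0) →
        ∀ R₁ R₂ : ℝ, 0 < R₂ → R₂ < R₁ →
          Set.range (x 0) ⊆ cap c R₁ θ 0 \ cap c R₂ θ 0 →
          ∀ t ∈ timeInterval T, Set.range (x t) ⊆ cap c R₁ θ 0 \ cap c R₂ θ 0) ∧
    -- uniform bound for the logarithmic radial function
    (∀ K : ℝ, ∃ C : ℝ, ∀ (T : EReal) (u : ℝ → Amb n → ℝ),
        0 < T → IsScalarSolution c θ T u → (∀ z ∈ hemisphere n, |u 0 z| ≤ K) →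
        ∀ t ∈ timeInterval T, ∀ z ∈ hemisphere n, |u t z| ≤ C) := by
  have hsin : 0 < Real.sin θ := Real.sin_pos_of_pos_of_lt_pi hθ hθ'
  refine ⟨?_, fun K => scalar_bound hsin c K⟩
  intro M _ _ _ _ _ T x ν hT hx hstar R₁ R₂ hR₂ hR₁₂ h0 t ht
  have hR₁ : 0 < R₁ := hR₂.trans hR₁₂
  have hzero : (0 : ℝ) ∈ timeInterval T := ⟨le_rfl, by exact_mod_cast hT⟩
  have hmem : ∀ s ∈ timeInterval T, ∀ R, 0 < R → ∀ p,
      x s p ∈ cap c R θ 0 ↔ capRadius θ (x s p - c • Eₗ n) ≤ R := fun s hs R hR p =>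
    mem_cap_iff hsin hR ((hx.capillary s hs).height_pos p)
      ((hx.capillary s hs).apply_zero_nonneg p)
  have h1 : ∀ p, capRadius θ (x 0 p - c • Eₗ n) ≤ R₁ := fun p =>
    (hmem 0 hzero R₁ hR₁ p).1 (h0 ⟨p, rfl⟩).1
  have h2 : ∀ p, R₂ < capRadius θ (x 0 p - c • Eₗ n) := fun p =>
    not_le.1 fun h => (h0 ⟨p, rfl⟩).2 ((hmem 0 hzero R₂ hR₂ p).2 h)
  rintro _ ⟨p, rfl⟩
  refine ⟨(hmem t ht R₁ hR₁ p).2 (hx.capRadius_le hsin hR₁ h1 ht p), fun h => ?_⟩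
  exact absurd ((hmem t ht R₂ hR₂ p).1 h) (not_le.2 (hx.lt_capRadius hsin hstar hR₂ h2 ht p))
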